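/- Let $X_1,X_2,\dots$ be i.i.d. real random variables with distribution function $F$ and a density $f\ge 0$ with $\sup_{x\in\mathbb R} f(x)<\infty$. Let $r(F)=\sup\{x:F(x)<1\}\le\infty$, $\bar F=1-F$, $\Lambda(x)=\exp(-e^{-x})$ and $\lambda(x)=e^{-x}e^{-e^{-x}}$. Suppose that $F$ is in the max domain of attraction of $\Lambda$, i.e. there are $\alpha_n>0$, $\beta_n\in\mathbb R$ with $F^n(\alpha_n x+\beta_n)\to\Lambda(x)$ for all $x\in\mathbb R$. Suppose that on a left neighbourhood of $r(F)$ the function $F$ is twice differentiable with $F'=f>0$, and that, writing $F=\exp(-e^{-\eta})$, one has $$\left(\frac1{\eta'}\right)'(x)\to 0\qquad (x\uparrow r(F)).$$ Put $h(x)=\sup_{x<y<r(F)}\left|(1/\eta')'(y)\right|\in[0,\infty]$. Let $u$ be either of the auxiliary functions $u(t)=\int_t^{r(F)}\bar F(s)\,ds/\bar F(t)$ or $u=1/\eta'$ (the result holds for each choice), and let $$b_n=\inf\{x:F(x)>1-1/n\},\qquad a_n=u(b_n).$$ Assume that there are $k>0$, $0<c<k^{-1}$, $b>0$, $d>0$ and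 $n_0$ such that for all $n\ge n_0$ we have $b_n>0$, $$\frac{u(b_n)}{b_n h(b_n)}\le k \qquad\text{and}\qquad \frac{h(b_n(1-ck))}{h(b_n)}\le d(1-ck)^{-b}$$ (with $t/0=\infty$ for $t>0$). Then for all large $n$ the normalized maximum $(\max(X_1,\dots,X_n)-b_n)/a_n$ has the density $$g_n(x)=n\,a_n f(a_nx+b_n)F^{n-1}(a_nx+b_n),$$ and there are sequences $R_1(n)=O(h(b_n))$, $R_2(n)=O(\log(1+h(b_n)))$, $R_3(n)=O(ne^{-\sqrt n})$ as $n\to\infty$ such that for all large $n$ $$\sup_{x\in\mathbb R}|g_n(x)-\lambda(x)|<R_1(n)+R_2(n)+R_3(n).$$ -/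

import Mathlib

open MeasureTheory ProbabilityTheory Filter Topology Asymptotics
open scoped ENNReal

noncomputable section

namespace GumbelRate

/-- The Gumbel distribution function `Λ`. -/
def gumbelCdf (x : ℝ) : ℝ := Real.exp (-Real.exp (-x))

/-- The Gumbel density `λ`. -/
def gumbelDensity (x : ℝ) : ℝ := Real.exp (-x) * Real.exp (-Real.exp (-x))

/-- `F` belongs to the max domain of attraction of the Gumbel law under linear normalization. -/
def InGumbelDomain (F : ℝ → ℝ) : Prop :=
  ∃ a b : ℕ → ℝ, (∀ n, 0 < a n) ∧
    ∀ x : ℝ, Tendsto (fun n => F (a n * x + b n) ^ n) atTop (𝓝 (gumbelCdf x))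

/-- The right extremity `r(F) = sup {x : F x < 1}`, possibly `+∞`. -/
def rightEnd (F : ℝ → ℝ) : EReal := ⨆ x ∈ {x : ℝ | F x < 1}, (x : EReal)

/-- The filter of real `x` tending to `r(F)` from the left
(it is `atTop` when `r(F) = +∞`). -/
def toRightEnd (F : ℝ → ℝ) : Filter ℝ :=
  comap (fun x : ℝ => (x : EReal)) (𝓝[<] (rightEnd F))

/-- The function `η` with `F = exp (-exp (-η))` (meaningful where `0 < F < 1`). -/
def eta (F : ℝ → ℝ) (x : ℝ) : ℝ := -Real.log (-Real.log (F x))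

/-- The function `1 / η'`. -/
def invEtaDeriv (F : ℝ → ℝ) (x : ℝ) : ℝ := 1 / deriv (eta F) x

/-- The von Mises function `(1 / η')'`. -/
def vonMisesFun (F : ℝ → ℝ) : ℝ → ℝ := deriv (invEtaDeriv F)

/-- The nonincreasing envelope `h(x) = sup {|(1/η')'(y)| : x < y < r(F)}` of the von Mises
function; the supremum is taken in `[0, ∞]`, so an unbounded set has supremum `∞`. -/
def envelope (F : ℝ → ℝ) (x : ℝ) : ℝ≥0∞ :=
  ⨆ y ∈ {y : ℝ | x < y ∧ (y : EReal) < rightEnd F}, ENNReal.ofReal |vonMisesFun F y|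

/-- The auxiliary function `t ↦ (∫_t^{r(F)} (1 - F(s)) ds) / (1 - F(t))`; the integrand vanishes
to the right of `r(F)`. -/
def meanExcess (F : ℝ → ℝ) (t : ℝ) : ℝ := (∫ s in Set.Ioi t, (1 - F s)) / (1 - F t)

/-- The centering constants `b_n = inf {x : F x > 1 - 1/n}` (meaningful for `n ≥ 2`). -/
def centering (F : ℝ → ℝ) (n : ℕ) : ℝ := sInf {x : ℝ | 1 - 1 / (n : ℝ) < F x}

/-- The density at `x` of `(M_n - b) / a`, where `M_n` is the maximum of `n` independent random
variables with distribution function `F` and density `f`. -/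
def maxDensity (F f : ℝ → ℝ) (a b : ℝ) (n : ℕ) (x : ℝ) : ℝ :=
  n * a * f (a * x + b) * F (a * x + b) ^ (n - 1)

/-- `F` is twice differentiable with derivative `f > 0` on a left neighbourhood of `r(F)`, and
the von Mises function `(1 / η')'` tends to `0` at `r(F)`. -/
def VonMisesCondition (F f : ℝ → ℝ) : Prop :=
  (∀ᶠ x in toRightEnd F, HasDerivAt F (f x) x ∧ DifferentiableAt ℝ f x ∧ 0 < f x) ∧
    Tendsto (vonMisesFun F) (toRightEnd F) (𝓝 0)

end GumbelRate

end

/-! Write v = 1/η', B = b_n, H = h(B), ρ = a_n/v(B), z = a_n x + B and κ = n exp(-η(B)). Since v f =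
F exp(-η) in the tail, g_n(x) = ρ (v(B)/v(z)) λ(η(z) - η(B) - log κ) there (`maxDensity_eq`). If v
were constant, η would be affine and only ρ and κ would separate this from λ(x). The error is thus
governed by v', which h bounds.

The growth conditions force r(F) = ∞ (`lt_one_of_envelope_bounds`). The bound on u(B) then makes the
window |z - B| ≤ v(B) δ/H shorter than a small fraction of B, and the bound on h(B(1-ck)) gives |v'|
= O(H) on it. Inside, v(B)/v(z) and the slope of η are 1 + O(H|x|), and the exponential decay of λ
absorbs the powers of |x| (`abs_perturbed_gumbelDensity_sub_le`). Outside, |x| is at least of order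
1/H and both densities are O(H) (`eta_far`, `le_mul_exp`). Left of the regular tail, g_n is
geometrically small in n.

The remaining errors ρ - 1 and κ - 1 are O(H + exp(-η(B))) (`abs_div_meanExcess_sub_one_le`,
`mul_exp_neg_eta_bounds`), and exp(-η(B)) = O(v(B)/B) = O(H) (`exists_exp_neg_le`). The whole error
is therefore O(h(b_n)). -/

namespace GumbelRate

/-! ### The law of the normalized maximum. -/

section Density

variable {μ : Measure ℝ} [IsProbabilityMeasure μ] {F f : ℝ → ℝ}

theorem eq_cdf (hF : ∀ x, F x = μ.real (Set.Iic x)) : F = cdf μ :=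
  funext fun x => by rw [hF, cdf_eq_real]

theorem sub_le_mul_of_density_le {M : ℝ} (hF : ∀ x, F x = μ.real (Set.Iic x))
    (hμ : μ = volume.withDensity (fun x => ENNReal.ofReal (f x)))
    (hM : ∀ x, f x ≤ M) {x y : ℝ} (hxy : x ≤ y) : F y - F x ≤ M * (y - x) := by
  have h1 : F y - F x = μ.real (Set.Ioc x y) := by
    rw [hF, hF, ← measureReal_sdiff (Set.Iic_subset_Iic.2 hxy) measurableSet_Iic]
    congr 1
    ext z
    simp [and_comm]
  by_cases hM0 : 0 ≤ M
  · rw [h1, measureReal_def, hμ, withDensity_apply _ measurableSet_Ioc]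
    refine ENNReal.toReal_le_of_le_ofReal (mul_nonneg hM0 (by linarith)) ?_
    calc ∫⁻ a in Set.Ioc x y, ENNReal.ofReal (f a)
        ≤ ∫⁻ _ in Set.Ioc x y, ENNReal.ofReal M :=
          lintegral_mono fun a => ENNReal.ofReal_le_ofReal (hM a)
      _ = ENNReal.ofReal (M * (y - x)) := by
          rw [setLIntegral_const, Real.volume_Ioc, ENNReal.ofReal_mul hM0]
  · exfalso
    have : μ Set.univ = 0 := by
      rw [hμ, withDensity_apply _ MeasurableSet.univ]
      refine (lintegral_congr fun a => ?_).trans lintegral_zero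
      exact ENNReal.ofReal_of_nonpos ((hM a).trans (not_le.1 hM0).le)
    simp at this

theorem lipschitzWith_of_density_le {M : ℝ} (hF : ∀ x, F x = μ.real (Set.Iic x))
    (hμ : μ = volume.withDensity (fun x => ENNReal.ofReal (f x)))
    (hM : ∀ x, f x ≤ M) : LipschitzWith M.toNNReal F := by
  refine LipschitzWith.of_dist_le_mul fun x y => ?_
  have hmono : Monotone F := by rw [eq_cdf hF]; exact monotone_cdf μ
  have key : ∀ x y : ℝ, x ≤ y → |F x - F y| ≤ M.toNNReal * |x - y| := fun x y hxy => by
    rw [abs_sub_comm, abs_of_nonneg (sub_nonneg.2 (hmono hxy)), abs_sub_comm,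
      abs_of_nonneg (sub_nonneg.2 hxy)]
    exact (sub_le_mul_of_density_le hF hμ hM hxy).trans
      (mul_le_mul_of_nonneg_right (Real.le_coe_toNNReal M) (sub_nonneg.2 hxy))
  rw [Real.dist_eq, Real.dist_eq]
  rcases le_total x y with h | h
  · exact key x y h
  · rw [abs_sub_comm, abs_sub_comm x]; exact key y x h

/-- Lebesgue differentiation: a distribution function has the Radon–Nikodym derivative of its
measure as derivative almost everywhere. -/
theorem ae_hasDerivAt_of_density (hF : ∀ x, F x = μ.real (Set.Iic x)) (hfm : Measurable f)
    (hf0 : ∀ x, 0 ≤ f x) (hμ : μ = volume.withDensity (fun x => ENNReal.ofReal (f x))) :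
    ∀ᵐ x, HasDerivAt F (f x) x := by
  have h := (cdf μ).ae_hasDerivAt
  rw [measure_cdf] at h
  have h2 : μ.rnDeriv volume =ᵐ[volume] fun x => ENNReal.ofReal (f x) := by
    rw [hμ]
    exact Measure.rnDeriv_withDensity _ hfm.ennreal_ofReal
  rw [eq_cdf hF]
  filter_upwards [h, h2] with x hx hx2
  rwa [hx2, ENNReal.toReal_ofReal (hf0 x)] at hx

theorem ae_comp_affine {p : ℝ → Prop} (h : ∀ᵐ x, p x) {a : ℝ} (ha : a ≠ 0) (b : ℝ) :
    ∀ᵐ x : ℝ, p (a * x + b) := by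
  have h1 : ∀ᵐ x : ℝ, p (x + b) := by
    exact (measurePreserving_add_right volume b).quasiMeasurePreserving.ae h
  have hq : Measure.QuasiMeasurePreserving (fun x : ℝ => a * x) volume volume := by
    refine ⟨measurable_const_mul a, ?_⟩
    have := Real.map_volume_mul_left ha
    rw [this]
    exact Measure.smul_absolutelyContinuous
  exact hq.ae h1

theorem measureReal_iSup_le {Ω : Type*} [MeasurableSpace Ω] (P : Measure Ω) [IsProbabilityMeasure P]
    (X : ℕ → Ω → ℝ) (hXind : iIndepFun X P)
    (hF : ∀ i x, F x = P.real {ω | X i ω ≤ x}) {n : ℕ} (hn : n ≠ 0) (x : ℝ) :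
    P.real {ω | (⨆ i : Fin n, X i ω) ≤ x} = F x ^ n := by
  -- For `n = 0` the supremum would be the default value 0.
  have : Nonempty (Fin n) := ⟨⟨0, Nat.pos_of_ne_zero hn⟩⟩
  have h1 : {ω | (⨆ i : Fin n, X i ω) ≤ x} = ⋂ i ∈ Finset.range n, X i ⁻¹' Set.Iic x := by
    ext ω
    simp only [Set.mem_ofPred_eq, Set.mem_iInter, Set.mem_preimage, Set.mem_Iic, Finset.mem_range]
    rw [ciSup_le_iff (Set.finite_range _).bddAbove]
    exact ⟨fun h i hi => h ⟨i, hi⟩, fun h i => h i i.2⟩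
  have h2 := hXind.measure_inter_preimage_eq_mul (Finset.range n) (sets := fun _ => Set.Iic x)
    (fun i _ => measurableSet_Iic)
  rw [measureReal_def, h1, h2, ENNReal.toReal_prod]
  rw [Finset.prod_congr rfl (g := fun _ => F x) fun i _ => by rw [hF i x]; rfl]
  simp

/-- The normalized maximum of `n` independent variables with common bounded density `f` and
distribution function `F` has density `maxDensity F f a b n`. -/
theorem map_normalized_iSup {Ω : Type*} [MeasurableSpace Ω] (P : Measure Ω)
    [IsProbabilityMeasure P] (X : ℕ → Ω → ℝ) (hXm : ∀ i, Measurable (X i)) (hXind : iIndepFun X P)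
    (hF : ∀ i x, F x = P.real {ω | X i ω ≤ x}) (hfm : Measurable f) (hf0 : ∀ x, 0 ≤ f x)
    (hf : ∀ i, P.map (X i) = volume.withDensity (fun x => ENNReal.ofReal (f x)))
    (hfb : BddAbove (Set.range f)) {n : ℕ} (hn : n ≠ 0) {a : ℝ} (ha : 0 < a) (b : ℝ) :
    P.map (fun ω => ((⨆ i : Fin n, X i ω) - b) / a) =
      volume.withDensity (fun x => ENNReal.ofReal (maxDensity F f a b n x)) := by
  have hprob : IsProbabilityMeasure (P.map (X 0)) :=
    Measure.isProbabilityMeasure_map (hXm 0).aemeasurable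
  have hF0 : ∀ x, F x = (P.map (X 0)).real (Set.Iic x) := fun x => by
    rw [hF 0, measureReal_def, measureReal_def, Measure.map_apply (hXm 0) measurableSet_Iic]; rfl
  obtain ⟨M, hM⟩ := hfb
  have hM' : ∀ x, f x ≤ M := fun x => hM ⟨x, rfl⟩
  have hF01 : ∀ x, 0 ≤ F x ∧ F x ≤ 1 := fun x => by
    rw [eq_cdf hF0]; exact ⟨cdf_nonneg _ x, cdf_le_one _ x⟩
  have hlip := lipschitzWith_of_density_le hF0 (hf 0) hM'
  have hder := ae_hasDerivAt_of_density hF0 hfm hf0 (hf 0)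
  set G : ℝ → ℝ := fun x => F (a * x + b) ^ n with hG
  have hGder : ∀ᵐ x, HasDerivAt G (maxDensity F f a b n x) x := by
    filter_upwards [ae_comp_affine hder ha.ne' b] with x hx
    have h1 : HasDerivAt (fun x : ℝ => a * x + b) a x := by
      simpa using ((hasDerivAt_id x).const_mul a).add_const b
    have h2 := (hx.comp x h1).pow n
    refine HasDerivAt.congr_deriv (f := G) h2 ?_
    simp only [maxDensity, Function.comp]
    ring
  have hGlip : ∃ K, LipschitzWith K G := by
    have haff : LipschitzWith a.toNNReal (fun x : ℝ => a * x + b) := by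
      refine LipschitzWith.of_dist_le_mul fun x y => ?_
      rw [Real.dist_eq, Real.dist_eq, Real.coe_toNNReal a ha.le]
      rw [show a * x + b - (a * y + b) = a * (x - y) by ring, abs_mul, abs_of_pos ha]
    have h1 := hlip.comp haff
    refine ⟨n * (M.toNNReal * a.toNNReal), LipschitzWith.of_dist_le_mul fun x y => ?_⟩
    have h2 := h1.dist_le_mul x y
    simp only [Function.comp, Real.dist_eq] at h2 ⊢
    have h4 : max |F (a * x + b)| |F (a * y + b)| ^ (n - 1) ≤ 1 := by
      refine pow_le_one₀ (by positivity) (max_le ?_ ?_) <;>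
      · rw [abs_of_nonneg (hF01 _).1]
        exact (hF01 _).2
    calc |F (a * x + b) ^ n - F (a * y + b) ^ n|
        ≤ |F (a * x + b) - F (a * y + b)| * n * max |F (a * x + b)| |F (a * y + b)| ^ (n - 1) :=
          abs_pow_sub_pow_le _ _ _
      _ ≤ |F (a * x + b) - F (a * y + b)| * n * 1 := by gcongr
      _ ≤ ((M.toNNReal * a.toNNReal : NNReal) * |x - y|) * n * 1 := by gcongr
      _ = _ := by push_cast; ring
  -- The derivative is known only almost everywhere; absolute continuity, from the Lipschitz bound,
  -- lets its integral recover the increments of `G`.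
  have hGac : ∀ x y, AbsolutelyContinuousOnInterval G x y := fun x y => by
    obtain ⟨K, hK⟩ := hGlip
    exact hK.lipschitzOnWith.absolutelyContinuousOnInterval
  have hmeas : Measurable (fun ω => (⨆ i : Fin n, X i ω)) :=
    Measurable.iSup fun i : Fin n => hXm i
  have hmeas' : Measurable (fun ω => ((⨆ i : Fin n, X i ω) - b) / a) :=
    (hmeas.sub_const b).div_const a
  have hprob' : IsProbabilityMeasure (P.map fun ω => ((⨆ i : Fin n, X i ω) - b) / a) :=
    Measure.isProbabilityMeasure_map hmeas'.aemeasurable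
  have hcdf : ∀ x, (P.map fun ω => ((⨆ i : Fin n, X i ω) - b) / a).real (Set.Iic x) = G x := by
    intro x
    rw [measureReal_def, Measure.map_apply hmeas' measurableSet_Iic]
    refine Eq.trans ?_ (measureReal_iSup_le P X hXind hF hn (a * x + b))
    rw [measureReal_def]
    congr 2
    ext ω
    simp only [Set.mem_preimage, Set.mem_Iic, Set.mem_ofPred_eq]
    rw [div_le_iff₀ ha, sub_le_iff_le_add, mul_comm]
  refine Measure.ext_of_Ioc _ _ fun x y hxy => ?_
  have hl : (P.map fun ω => ((⨆ i : Fin n, X i ω) - b) / a) (Set.Ioc x y)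
      = ENNReal.ofReal (G y - G x) := by
    rw [← hcdf, ← hcdf, ← measureReal_sdiff (Set.Iic_subset_Iic.2 hxy.le) measurableSet_Iic,
      measureReal_def, ENNReal.ofReal_toReal (measure_ne_top _ _)]
    congr 1
    ext z
    simp [and_comm]
  have hd0 : ∀ x, 0 ≤ maxDensity F f a b n x := fun x => by
    have := hf0 (a * x + b)
    have := (hF01 (a * x + b)).1
    unfold maxDensity
    positivity
  have hae : ∀ᵐ s, deriv G s = maxDensity F f a b n s := hGder.mono fun s hs => hs.deriv
  have hint : IntegrableOn (maxDensity F f a b n) (Set.Ioc x y) := by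
    have := (intervalIntegrable_iff_integrableOn_Ioc_of_le hxy.le).1
      (hGac x y).intervalIntegrable_deriv
    exact this.congr (ae_restrict_of_ae hae)
  rw [hl, withDensity_apply _ measurableSet_Ioc,
    ← ofReal_integral_eq_lintegral_ofReal hint (ae_of_all _ hd0)]
  congr 1
  rw [← (hGac x y).integral_deriv_eq_sub, intervalIntegral.integral_of_le hxy.le]
  exact integral_congr_ae (ae_restrict_of_ae hae)

end Density

end GumbelRate

namespace GumbelRate

/-! ### Decay and perturbation of the Gumbel density. -/

section GumbelDensity

theorem pow_mul_exp_neg_le (k : ℕ) {w : ℝ} (hw : 0 ≤ w) :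
    w ^ k * Real.exp (-w) ≤ k.factorial := by
  have h := Real.pow_div_factorial_le_exp w hw k
  rw [Real.exp_neg, ← div_eq_mul_inv, div_le_iff₀ (Real.exp_pos w)]
  rwa [div_le_iff₀ (by positivity), mul_comm] at h

theorem mul_exp_neg_half_le {y : ℝ} (hy : 0 ≤ y) : y * Real.exp (-y / 2) ≤ 2 := by
  have h := pow_mul_exp_neg_le 1 (w := y / 2) (by positivity)
  rw [show -(y / 2) = -y / 2 by ring] at h
  norm_num at h
  linarith

theorem sq_mul_exp_neg_half_le {y : ℝ} (hy : 0 ≤ y) : y ^ 2 * Real.exp (-y / 2) ≤ 8 := by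
  have h := pow_mul_exp_neg_le 2 (w := y / 2) (by positivity)
  rw [show -(y / 2) = -y / 2 by ring, div_pow] at h
  norm_num [Nat.factorial] at h
  linarith

theorem gumbelDensity_nonneg (s : ℝ) : 0 ≤ gumbelDensity s := by
  unfold gumbelDensity; positivity

theorem gumbelDensity_le (s : ℝ) : gumbelDensity s ≤ 2 * Real.exp (-|s|) := by
  unfold gumbelDensity
  rcases le_total 0 s with hs | hs
  · rw [abs_of_nonneg hs]
    have h1 : Real.exp (-Real.exp (-s)) ≤ 1 := Real.exp_le_one_iff.2 (by simp [Real.exp_nonneg])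
    nlinarith [Real.exp_pos (-s)]
  · rw [abs_of_nonpos hs, neg_neg]
    have h := pow_mul_exp_neg_le 2 (Real.exp_pos (-s)).le
    norm_num [Nat.factorial] at h
    have h2 : Real.exp s * Real.exp (-s) = 1 := by rw [← Real.exp_add]; simp
    calc Real.exp (-s) * Real.exp (-Real.exp (-s))
        = Real.exp s * (Real.exp (-s) ^ 2 * Real.exp (-Real.exp (-s))) := by
          linear_combination (-Real.exp (-s) * Real.exp (-Real.exp (-s))) * h2
      _ ≤ Real.exp s * 2 := by gcongr
      _ = 2 * Real.exp s := mul_comm _ _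

theorem hasDerivAt_gumbelDensity (s : ℝ) :
    HasDerivAt gumbelDensity (gumbelDensity s * (Real.exp (-s) - 1)) s := by
  have h1 : HasDerivAt (fun s : ℝ => Real.exp (-s)) (-Real.exp (-s)) s := by
    simpa using (hasDerivAt_neg s).exp
  have h2 := h1.mul h1.neg.exp
  refine HasDerivAt.congr_deriv (f := gumbelDensity) h2 ?_
  simp only [gumbelDensity, Pi.neg_apply]
  ring

theorem abs_deriv_gumbelDensity_le (s : ℝ) :
    |gumbelDensity s * (Real.exp (-s) - 1)| ≤ 8 * Real.exp (-|s|) := by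
  unfold gumbelDensity
  set w := Real.exp (-s) with hw
  have hw0 : 0 < w := Real.exp_pos _
  have h1 := pow_mul_exp_neg_le 3 hw0.le
  have h2 := pow_mul_exp_neg_le 2 hw0.le
  norm_num [Nat.factorial] at h1 h2
  have he : 0 < Real.exp (-w) := Real.exp_pos _
  have he1 : Real.exp (-w) ≤ 1 := Real.exp_le_one_iff.2 (by linarith)
  rw [abs_mul, abs_of_pos (by positivity)]
  have habs : |w - 1| ≤ w + 1 := by
    rw [abs_le]; constructor <;> linarith
  refine (mul_le_mul_of_nonneg_left habs (by positivity)).trans ?_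
  rcases le_total 0 s with hs | hs
  · rw [abs_of_nonneg hs, ← hw]
    have hw1 : w ≤ 1 := Real.exp_le_one_iff.2 (by linarith)
    calc w * Real.exp (-w) * (w + 1) ≤ w * 1 * (1 + 1) := by gcongr
      _ ≤ 8 * w := by linarith
  · rw [abs_of_nonpos hs, neg_neg]
    have h3 : Real.exp s * w = 1 := by rw [hw, ← Real.exp_add]; simp
    calc w * Real.exp (-w) * (w + 1)
        = Real.exp s * (w ^ 3 * Real.exp (-w) + w ^ 2 * Real.exp (-w)) := by
          linear_combination (-w * Real.exp (-w) * (w + 1)) * h3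
      _ ≤ Real.exp s * (6 + 2) := by gcongr
      _ = 8 * Real.exp s := by ring

theorem abs_gumbelDensity_sub_le {m s t : ℝ} (h : ∀ y ∈ Set.uIcc s t, m ≤ |y|) :
    |gumbelDensity s - gumbelDensity t| ≤ 8 * Real.exp (-m) * |s - t| := by
  have := (convex_uIcc s t).norm_image_sub_le_of_norm_hasDerivWithin_le (f := gumbelDensity)
    (f' := fun y => gumbelDensity y * (Real.exp (-y) - 1)) (C := 8 * Real.exp (-m))
    (fun y _ => (hasDerivAt_gumbelDensity y).hasDerivWithinAt)
    (fun y hy => (abs_deriv_gumbelDensity_le y).trans (by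
      have := h y hy
      gcongr)) Set.right_mem_uIcc Set.left_mem_uIcc
  simpa [Real.norm_eq_abs] using this

theorem abs_gumbelDensity_sub_le_abs_sub (s t : ℝ) :
    |gumbelDensity s - gumbelDensity t| ≤ 8 * |s - t| := by
  simpa using abs_gumbelDensity_sub_le (m := 0) (s := s) (t := t) fun y _ => abs_nonneg y

/-- Every point between `α * x` and `x` has modulus at least |x|/2, so the derivative there keeps
the decay exp(-|x|/2). -/
theorem abs_gumbelDensity_mul_sub_le {α : ℝ} (hα : 1 / 2 ≤ α) (x : ℝ) :
    |gumbelDensity (α * x) - gumbelDensity x| ≤ 8 * |α - 1| * (|x| * Real.exp (-|x| / 2)) := by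
  have h := abs_gumbelDensity_sub_le (m := |x| / 2) (s := α * x) (t := x) (by
    intro y hy
    obtain ⟨β, hβ, rfl⟩ : ∃ β, 1 / 2 ≤ β ∧ y = β * x := by
      rw [← segment_eq_uIcc] at hy
      obtain ⟨p, q, hp, hq, hpq, rfl⟩ := hy
      refine ⟨p * α + q, by nlinarith, by simp only [smul_eq_mul]; ring⟩
    rw [abs_mul, abs_of_nonneg (show 0 ≤ β by linarith)]
    nlinarith [abs_nonneg x])
  rw [show α * x - x = (α - 1) * x by ring, abs_mul, ← neg_div] at h
  linarith

theorem gumbelDensity_sub_log {κ : ℝ} (hκ : 0 < κ) (t : ℝ) :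
    gumbelDensity (t - Real.log κ) =
      κ * Real.exp (-t) * Real.exp (-(κ * Real.exp (-t))) := by
  unfold gumbelDensity
  rw [neg_sub, sub_eq_add_neg, Real.exp_add, Real.exp_log hκ]

theorem abs_log_le_sub_one {κ : ℝ} (hκ : 1 ≤ κ) : |Real.log κ| ≤ κ - 1 := by
  rw [abs_of_nonneg (Real.log_nonneg hκ)]
  exact Real.log_le_sub_one_of_pos (by linarith)

theorem gumbelDensity_sub_log_le {κ : ℝ} (hκ : 1 ≤ κ) (hκ2 : κ ≤ 2) (t : ℝ) :
    gumbelDensity (t - Real.log κ) ≤ 4 * Real.exp (-|t|) := by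
  have hκ0 : 0 < κ := by linarith
  refine (gumbelDensity_le _).trans ?_
  have h1 : |t| - Real.log κ ≤ |t - Real.log κ| := by
    have := abs_sub_abs_le_abs_sub t (Real.log κ)
    rwa [abs_of_nonneg (Real.log_nonneg hκ)] at this
  calc 2 * Real.exp (-|t - Real.log κ|) ≤ 2 * Real.exp (Real.log κ + -|t|) := by
        gcongr; linarith
    _ = 2 * (κ * Real.exp (-|t|)) := by rw [Real.exp_add, Real.exp_log hκ0]
    _ ≤ 2 * (2 * Real.exp (-|t|)) := by gcongr
    _ = _ := by ring

/-- Perturbation estimate for the Gumbel density: multiplicative and additive perturbations of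
relative size at most `A` (resp. `A |x|`) change it by `O(A)`, uniformly in `x`. -/
theorem abs_perturbed_gumbelDensity_sub_le {A x r q ρ κ : ℝ} (hA : 0 ≤ A)
    (hr : |r - 1| ≤ A * |x|) (hq : |q - 1| ≤ A * |x|) (hr2 : 1 / 2 ≤ r) (hq0 : 0 ≤ q) (hq2 : q ≤ 2)
    (hρ : |ρ - 1| ≤ A) (hρ2 : |ρ - 1| ≤ 1 / 2) (hκ : 1 ≤ κ) (hκA : κ - 1 ≤ A) (hκ2 : κ ≤ 2) :
    |ρ * q * gumbelDensity (r * x - Real.log κ) - gumbelDensity (x / ρ)| ≤ 128 * A := by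
  have hρ3 := abs_le.1 hρ2
  have hρ0 : 0 < ρ := by linarith
  have hy : 0 ≤ |x| := abs_nonneg x
  set y := |x| with hyd
  have e1 := mul_exp_neg_half_le hy
  have e2 := sq_mul_exp_neg_half_le hy
  have e0 : Real.exp (-y / 2) ≤ 1 := Real.exp_le_one_iff.2 (by linarith)
  have ep := Real.exp_pos (-y / 2)
  have t1 : |gumbelDensity x - gumbelDensity (x / ρ)| ≤ 32 * A := by
    have hα : 1 / 2 ≤ ρ⁻¹ := by
      rw [one_div]; exact inv_anti₀ hρ0 (by linarith)
    have h := abs_gumbelDensity_mul_sub_le hα x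
    rw [abs_sub_comm, div_eq_inv_mul]
    have hinv : |ρ⁻¹ - 1| ≤ 2 * A := by
      rw [show ρ⁻¹ - 1 = ρ⁻¹ * (1 - ρ) by field_simp, abs_mul, abs_sub_comm,
        abs_of_pos (inv_pos.2 hρ0)]
      have : ρ⁻¹ ≤ 2 := by
        rw [inv_le_comm₀ hρ0 two_pos]; linarith
      gcongr
    calc _ ≤ 8 * |ρ⁻¹ - 1| * (y * Real.exp (-y / 2)) := h
      _ ≤ 8 * (2 * A) * 2 := by gcongr
      _ = 32 * A := by ring
  -- The relative error in `r` is already of size `A * |x|`, so a second power of |x| has to be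
  -- absorbed.
  have t2 : |gumbelDensity (r * x) - gumbelDensity x| ≤ 64 * A := by
    calc _ ≤ 8 * |r - 1| * (y * Real.exp (-y / 2)) := abs_gumbelDensity_mul_sub_le hr2 x
      _ ≤ 8 * (A * y) * (y * Real.exp (-y / 2)) := by gcongr
      _ = 8 * A * (y ^ 2 * Real.exp (-y / 2)) := by ring
      _ ≤ 8 * A * 8 := by gcongr
      _ = 64 * A := by ring
  have t3 : |gumbelDensity (r * x - Real.log κ) - gumbelDensity (r * x)| ≤ 8 * A := by
    calc _ ≤ 8 * |r * x - Real.log κ - r * x| := abs_gumbelDensity_sub_le_abs_sub _ _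
      _ = 8 * |Real.log κ| := by rw [sub_right_comm, sub_self, zero_sub, abs_neg]
      _ ≤ 8 * A := by
        have := abs_log_le_sub_one hκ
        linarith
  have t4 : |(ρ * q - 1) * gumbelDensity (r * x - Real.log κ)| ≤ 16 * A := by
    rw [abs_mul, abs_of_nonneg (gumbelDensity_nonneg _)]
    have h1 : |ρ * q - 1| ≤ 2 * A + A * y := by
      rw [show ρ * q - 1 = (ρ - 1) * q + (q - 1) by ring]
      refine (abs_add_le _ _).trans (add_le_add ?_ hq)
      rw [abs_mul, abs_of_nonneg hq0, mul_comm]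
      gcongr
    have h2 : gumbelDensity (r * x - Real.log κ) ≤ 4 * Real.exp (-y / 2) := by
      refine (gumbelDensity_sub_log_le hκ hκ2 _).trans ?_
      gcongr
      rw [abs_mul, abs_of_nonneg (show 0 ≤ r by linarith)]
      nlinarith
    calc _ ≤ (2 * A + A * y) * (4 * Real.exp (-y / 2)) :=
          mul_le_mul h1 h2 (gumbelDensity_nonneg _) (by positivity)
      _ = 8 * A * Real.exp (-y / 2) + 4 * A * (y * Real.exp (-y / 2)) := by ring
      _ ≤ 8 * A * 1 + 4 * A * 2 := by gcongr
      _ = 16 * A := by ring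
  calc _ = |(ρ * q - 1) * gumbelDensity (r * x - Real.log κ)
          + (gumbelDensity (r * x - Real.log κ) - gumbelDensity (r * x))
          + (gumbelDensity (r * x) - gumbelDensity x)
          + (gumbelDensity x - gumbelDensity (x / ρ))| := by congr 1; ring
    _ ≤ 16 * A + 8 * A + 64 * A + 32 * A := by
      refine (abs_add_le _ _).trans (add_le_add ?_ t1)
      refine (abs_add_le _ _).trans (add_le_add ?_ t2)
      exact (abs_add_le _ _).trans (add_le_add t4 t3)
    _ ≤ 128 * A := by linarith

end GumbelDensity

end GumbelRate

/-! ### Consequences of a small derivative of v = 1/η'. -/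

namespace GumbelRate

/-- On `(l, ∞)` the function `v` is positive with derivative `w`, and `η` has derivative `1 / v`. -/
structure IsAuxiliary (η v w : ℝ → ℝ) (l : ℝ) : Prop where
  pos : ∀ s, l < s → 0 < v s
  hasDerivAt_eta : ∀ s, l < s → HasDerivAt η (1 / v s) s
  hasDerivAt_aux : ∀ s, l < s → HasDerivAt v (w s) s

namespace IsAuxiliary

variable {η v w : ℝ → ℝ} {l : ℝ}

theorem mono (h : IsAuxiliary η v w l) {l' : ℝ} (hl : l ≤ l') : IsAuxiliary η v w l' :=
  ⟨fun s hs => h.pos s (hl.trans_lt hs), fun s hs => h.hasDerivAt_eta s (hl.trans_lt hs),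
    fun s hs => h.hasDerivAt_aux s (hl.trans_lt hs)⟩

theorem antitoneOn_Ioi {g g' : ℝ → ℝ} (hg : ∀ s, l < s → HasDerivAt g (g' s) s)
    (hg' : ∀ s, l < s → g' s ≤ 0) : AntitoneOn g (Set.Ioi l) :=
  antitoneOn_of_hasDerivWithinAt_nonpos (convex_Ioi l)
    (fun s hs => (hg s hs).continuousAt.continuousWithinAt)
    (fun s hs => (hg s (interior_subset hs)).hasDerivWithinAt)
    (fun s hs => hg' s (interior_subset hs))

theorem monotoneOn_eta (h : IsAuxiliary η v w l) : MonotoneOn η (Set.Ioi l) :=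
  monotoneOn_of_hasDerivWithinAt_nonneg (convex_Ioi l)
    (fun s hs => (h.hasDerivAt_eta s hs).continuousAt.continuousWithinAt)
    (fun s hs => (h.hasDerivAt_eta s (interior_subset hs)).hasDerivWithinAt)
    (fun s hs => (one_div_pos.2 (h.pos s (interior_subset hs))).le)

theorem abs_sub_le (h : IsAuxiliary η v w l) {H b z : ℝ} (hb : l < b) (hz : l < z)
    (hw : ∀ s ∈ Set.uIcc b z, |w s| ≤ H) : |v z - v b| ≤ H * |z - b| := by
  have hsub : Set.uIcc b z ⊆ Set.Ioi l := fun s hs => lt_of_lt_of_le (lt_min hb hz) hs.1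
  exact (convex_uIcc b z).norm_image_sub_le_of_norm_hasDerivWithin_le
    (fun s hs => (h.hasDerivAt_aux s (hsub hs)).hasDerivWithinAt) hw
    Set.left_mem_uIcc Set.right_mem_uIcc

/-- By the mean value inequality v moves by at most half of v(b), so v(z) ≥ v(b)/2; dividing by v(z)
costs the factor 2. -/
theorem ratio_near (h : IsAuxiliary η v w l) {H b z : ℝ} (hb : l < b) (hz : l < z)
    (hw : ∀ s ∈ Set.uIcc b z, |w s| ≤ H) (hH : H * |(z - b) / v b| ≤ 1 / 2) :
    |v b / v z - 1| ≤ 2 * H * |(z - b) / v b| ∧ 1 / 2 ≤ v b / v z ∧ v b / v z ≤ 2 := by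
  have hvb := h.pos b hb
  have hvz := h.pos z hz
  set X := |(z - b) / v b| with hX
  have h1 : |v z - v b| ≤ H * X * v b := by
    have h2 := h.abs_sub_le hb hz hw
    rwa [show |z - b| = X * v b by rw [hX, abs_div, abs_of_pos hvb]; field_simp, ← mul_assoc] at h2
  have h3 := abs_le.1 h1
  have h4 : H * X * v b ≤ 1 / 2 * v b := by gcongr
  have h0 : 0 ≤ H * X * v b := (abs_nonneg _).trans h1
  refine ⟨?_, ?_, ?_⟩
  · rw [show v b / v z - 1 = (v b - v z) / v z by field_simp, abs_div, abs_of_pos hvz, abs_sub_comm,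
      div_le_iff₀ hvz]
    have h5 : 0 ≤ H * X := nonneg_of_mul_nonneg_left h0 hvb
    have : v b ≤ 2 * v z := by linarith
    nlinarith
  · rw [le_div_iff₀ hvz]; linarith
  · rw [div_le_iff₀ hvz]; linarith

/-- The mean value theorem gives the slope 1/v(ξ) with ξ between b and z, so r = v(b)/v(ξ) and
`ratio_near` applies at ξ. -/
theorem eta_near (h : IsAuxiliary η v w l) {H b z : ℝ} (hb : l < b) (hz : l < z) (hH0 : 0 ≤ H)
    (hw : ∀ s ∈ Set.uIcc b z, |w s| ≤ H) (hH : H * |(z - b) / v b| ≤ 1 / 2) :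
    ∃ r, η z - η b = r * ((z - b) / v b) ∧ |r - 1| ≤ 2 * H * |(z - b) / v b| ∧ 1 / 2 ≤ r := by
  have hvb := h.pos b hb
  obtain ⟨ξ, hξ, hξe⟩ : ∃ ξ ∈ Set.uIcc b z, η z - η b = (z - b) / v ξ := by
    rcases lt_trichotomy b z with hlt | heq | hlt
    · obtain ⟨ξ, hξ, he⟩ := exists_hasDerivAt_eq_slope η (fun s => 1 / v s) hlt
        (fun s hs => (h.hasDerivAt_eta s (hb.trans_le hs.1)).continuousAt.continuousWithinAt)
        (fun s hs => h.hasDerivAt_eta s (hb.trans hs.1))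
      refine ⟨ξ, Set.Icc_subset_uIcc ⟨hξ.1.le, hξ.2.le⟩, ?_⟩
      have := h.pos ξ (hb.trans hξ.1)
      have h2 : z - b ≠ 0 := by linarith
      field_simp at he ⊢
      linarith
    · subst heq
      exact ⟨b, Set.left_mem_uIcc, by simp⟩
    · obtain ⟨ξ, hξ, he⟩ := exists_hasDerivAt_eq_slope η (fun s => 1 / v s) hlt
        (fun s hs => (h.hasDerivAt_eta s (hz.trans_le hs.1)).continuousAt.continuousWithinAt)
        (fun s hs => h.hasDerivAt_eta s (hz.trans hs.1))
      refine ⟨ξ, Set.Icc_subset_uIcc' ⟨hξ.1.le, hξ.2.le⟩, ?_⟩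
      have := h.pos ξ (hz.trans hξ.1)
      have h2 : b - z ≠ 0 := by linarith
      field_simp at he ⊢
      linarith
  have hξl : l < ξ := lt_of_lt_of_le (lt_min hb hz) hξ.1
  have hle : |(ξ - b) / v b| ≤ |(z - b) / v b| := by
    rw [abs_div, abs_div]
    gcongr 1
    exact Set.abs_sub_left_of_mem_uIcc hξ
  obtain ⟨h1, h2, -⟩ := h.ratio_near hb hξl
    (fun s hs => hw s (Set.uIcc_subset_uIcc_left hξ hs))
    ((mul_le_mul_of_nonneg_left hle hH0).trans hH)
  have hvξ := h.pos ξ hξl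
  refine ⟨v b / v ξ, by rw [hξe]; field_simp, h1.trans (by gcongr), h2⟩

/-- Away from `b`, at a distance of at least `X v(b)`, the increments of `η` are at least `X / 2`,
provided that `v` is nearly constant in the window of radius `X v(b)` about `b`. -/
theorem eta_far (h : IsAuxiliary η v w l) {H b z X : ℝ} (hb : l < b) (hz : l < z) (hH0 : 0 ≤ H)
    (hX0 : 0 ≤ X) (hw : ∀ s, b - v b * X ≤ s → |w s| ≤ H) (hl : l < b - v b * X)
    (hX : H * X ≤ 1 / 2) (hzX : X ≤ |(z - b) / v b|) : X / 2 ≤ |η z - η b| := by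
  have hvb := h.pos b hb
  have hvX : 0 ≤ v b * X := by positivity
  have key : ∀ s, l < s → b - v b * X ≤ s → |(s - b) / v b| = X → X / 2 ≤ |η s - η b| := by
    intro s hs hs' hsX
    obtain ⟨r, h1, -, h3⟩ := h.eta_near hb hs hH0
      (fun y hy => hw y ((le_min (by linarith) hs').trans hy.1)) (by rwa [hsX])
    rw [h1, abs_mul, hsX, abs_of_nonneg (by linarith : 0 ≤ r)]
    nlinarith
  -- η is monotone, so the increment up to z is at least the one up to the edge of the window on the
  -- same side, where `key` applies.
  rcases le_total b z with hbz | hbz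
  · have h1 : X * v b ≤ z - b := by
      rwa [abs_of_nonneg (div_nonneg (sub_nonneg.2 hbz) hvb.le), le_div_iff₀ hvb] at hzX
    have h2 := key (b + v b * X) (by linarith) (by linarith)
      (by rw [add_sub_cancel_left, mul_div_cancel_left₀ _ hvb.ne', abs_of_nonneg hX0])
    have h3 := h.monotoneOn_eta hb (show l < b + v b * X by linarith) (by linarith)
    have h4 := h.monotoneOn_eta (show l < b + v b * X by linarith) hz (by linarith)
    rw [abs_of_nonneg (by linarith)] at h2 ⊢
    linarith
  · have h1 : X * v b ≤ b - z := by
      rwa [abs_div, abs_sub_comm, abs_of_pos hvb, abs_of_nonneg (sub_nonneg.2 hbz),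
        le_div_iff₀ hvb] at hzX
    have h2 := key (b - v b * X) (by linarith) (by linarith)
      (by rw [sub_sub_cancel_left, neg_div, abs_neg, mul_div_cancel_left₀ _ hvb.ne',
            abs_of_nonneg hX0])
    have h3 := h.monotoneOn_eta (show l < b - v b * X by linarith) hb (by linarith)
    have h4 := h.monotoneOn_eta hz (show l < b - v b * X by linarith) (by linarith)
    rw [abs_of_nonpos (by linarith)] at h2 ⊢
    linarith

/-- As a function of η, log v has derivative w. Hence v exp(-ση) is monotone for σ = ±ε. -/
theorem le_mul_exp (h : IsAuxiliary η v w l) {ε b z : ℝ} (hb : l < b) (hz : l < z)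
    (hw : ∀ s, l < s → |w s| ≤ ε) : v b ≤ v z * Real.exp (ε * |η z - η b|) := by
  have key : ∀ σ : ℝ, |σ| = ε → ∀ s, l < s →
      HasDerivAt (fun s => v s * Real.exp (-(σ * η s)))
        ((w s - σ) * Real.exp (-(σ * η s))) s := by
    intro σ hσ s hs
    have hv := h.pos s hs
    refine ((h.hasDerivAt_aux s hs).mul ((h.hasDerivAt_eta s hs).const_mul σ).neg.exp).congr_deriv
      ?_
    simp only [Pi.neg_apply]
    field_simp
    ring
  have hε : 0 ≤ ε := (abs_nonneg _).trans (hw b hb)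
  rcases le_total b z with hbz | hbz
  · have hm := antitoneOn_Ioi (l := l)
      (fun s hs => (key (-ε) (by rw [abs_neg, abs_of_nonneg hε]) s hs).neg)
      (fun s hs => by
        have := (abs_le.1 (hw s hs)).1
        have := Real.exp_pos (-(-ε * η s))
        nlinarith) hb hz hbz
    simp only [Pi.neg_apply] at hm
    rw [abs_of_nonneg (sub_nonneg.2 (h.monotoneOn_eta hb hz hbz))]
    rw [mul_sub, Real.exp_sub, ← mul_div_assoc, le_div_iff₀ (Real.exp_pos _)]
    rw [neg_mul, neg_neg, neg_mul, neg_neg] at hm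
    linarith
  · have hm := antitoneOn_Ioi (l := l) (fun s hs => key ε (abs_of_nonneg hε) s hs)
      (fun s hs => by
        have := (abs_le.1 (hw s hs)).2
        have := Real.exp_pos (-(ε * η s))
        nlinarith) hz hb hbz
    simp only at hm
    rw [abs_of_nonpos (sub_nonpos.2 (h.monotoneOn_eta hz hb hbz))]
    rw [show ε * -(η z - η b) = -(ε * η z) - (-(ε * η b)) by ring, Real.exp_sub, ← mul_div_assoc,
      le_div_iff₀ (Real.exp_pos _)]
    exact hm

/-- `v` grows at most like `exp (η / 2)`. -/
theorem exists_le_exp_half (h : IsAuxiliary η v w l) (hw : ∀ s, l < s → |w s| ≤ 1 / 8) :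
    ∃ C, 0 ≤ C ∧ ∀ s, l + 1 ≤ s → v s ≤ C * Real.exp (η s / 2) := by
  have hl1 : l < l + 1 := by linarith
  refine ⟨v (l + 1) * Real.exp (-(η (l + 1) / 2)),
    mul_nonneg (h.pos _ hl1).le (Real.exp_pos _).le, fun s hs => ?_⟩
  have hs' : l < s := by linarith
  have h1 := h.le_mul_exp hs' hl1 hw
  have hη := h.monotoneOn_eta hl1 hs' hs
  rw [abs_of_nonpos (by linarith)] at h1
  refine h1.trans ?_
  rw [mul_assoc, ← Real.exp_add]
  have := h.pos _ hl1
  gcongr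
  linarith

/-- Slope at most 1/8 gives v(s) ≤ (v(l+1) + |l+1|) + s/8, and past the chosen threshold the first
term is below s/8. -/
theorem exists_aux_le (h : IsAuxiliary η v w l) (hw : ∀ s, l < s → |w s| ≤ 1 / 8) :
    ∃ l', l ≤ l' ∧ 0 ≤ l' ∧ ∀ s, l' < s → v s ≤ s / 4 := by
  have hl1 : l < l + 1 := by linarith
  have hv := h.pos _ hl1
  refine ⟨max (l + 1) (8 * (v (l + 1) + |l + 1|)), by
    exact hl1.le.trans (le_max_left _ _), le_trans (by positivity) (le_max_right _ _), fun s hs => ?_⟩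
  have hs1 := (le_max_left _ _).trans_lt hs
  have hs2 := (le_max_right _ _).trans_lt hs
  have h1 := h.abs_sub_le (H := 1 / 8) hl1 (hl1.trans hs1)
    (fun y hy => hw y (hl1.trans_le ((le_min le_rfl hs1.le).trans hy.1)))
  rw [abs_of_nonneg (sub_nonneg.2 hs1.le)] at h1
  have := (abs_le.1 h1).2
  have := neg_abs_le (l + 1)
  have := abs_nonneg (l + 1)
  linarith

/-- `exp (-η)` is dominated by `v(s) / s`. -/
theorem exists_exp_neg_le (h : IsAuxiliary η v w l) (hw : ∀ s, l < s → |w s| ≤ 1 / 8) :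
    ∃ C l', 0 ≤ C ∧ l ≤ l' ∧ ∀ s, l' < s → Real.exp (-η s) ≤ C * (v s / s) := by
  obtain ⟨l₁, hl₁, hl0, hv⟩ := h.exists_aux_le hw
  -- The derivative of s exp(-η)/v has the sign of v - s(1 + w), which is negative because v ≤ s/4
  -- and w ≥ -1/8.
  have hanti := antitoneOn_Ioi (l := l₁) (g := fun s => s * Real.exp (-η s) / v s)
    (g' := fun s => Real.exp (-η s) / v s ^ 2 * (v s - s * (1 + w s))) (fun s hs => by
      have hls : l < s := hl₁.trans_lt hs
      have hvs := h.pos s hls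
      refine (((hasDerivAt_id s).mul (h.hasDerivAt_eta s hls).neg.exp).div (h.hasDerivAt_aux s hls)
        hvs.ne').congr_deriv ?_
      simp only [id, Pi.neg_apply, Pi.mul_apply]
      field_simp
      ring) (fun s hs => by
      have hls : l < s := hl₁.trans_lt hs
      have hvs := h.pos s hls
      have h1 := hv s hs
      have h2 := (abs_le.1 (hw s hls)).1
      have hs0 : 0 < s := hl0.trans_lt hs
      refine mul_nonpos_of_nonneg_of_nonpos (by positivity) ?_
      nlinarith)
  have h1 : l₁ < l₁ + 1 := by linarith
  have hv1 := h.pos (l₁ + 1) (hl₁.trans_lt h1)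
  refine ⟨(l₁ + 1) * Real.exp (-η (l₁ + 1)) / v (l₁ + 1), l₁ + 1, by positivity,
    by linarith, fun s hs => ?_⟩
  have hs' : l₁ < s := h1.trans hs
  have h2 := hanti h1 hs' hs.le
  have hvs := h.pos s (hl₁.trans_lt hs')
  have hs0 : 0 < s := hl0.trans_lt hs'
  simp only at h2
  rw [div_le_iff₀ hvs] at h2
  rw [← mul_div_assoc, le_div_iff₀ hs0]
  linarith

end IsAuxiliary

end GumbelRate

/-! ### Continuous distribution functions and the centering constants. -/

namespace GumbelRate

/-- `F` is a continuous distribution function. -/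
structure IsContinuousCdf (F : ℝ → ℝ) : Prop where
  mono : Monotone F
  cont : Continuous F
  tendsto_atBot : Tendsto F atBot (𝓝 0)
  tendsto_atTop : Tendsto F atTop (𝓝 1)

namespace IsContinuousCdf

variable {F : ℝ → ℝ}

theorem le_one (hF : IsContinuousCdf F) (x : ℝ) : F x ≤ 1 := hF.mono.ge_of_tendsto hF.tendsto_atTop x

theorem lt_rightEnd_iff (hF : IsContinuousCdf F) {x : ℝ} : (x : EReal) < rightEnd F ↔ F x < 1 := by
  constructor
  · intro h
    obtain ⟨y, hy, hxy⟩ := lt_biSup_iff.1 h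
    exact (hF.mono (EReal.coe_lt_coe_iff.1 hxy).le).trans_lt hy
  · intro h
    have h1 : ∀ᶠ y in 𝓝[>] x, F y < 1 :=
      (hF.cont.continuousAt.eventually_lt continuousAt_const h).filter_mono nhdsWithin_le_nhds
    obtain ⟨y, hy, hxy⟩ := (h1.and self_mem_nhdsWithin).exists
    exact lt_biSup_iff.2 ⟨y, hy, EReal.coe_lt_coe_iff.2 hxy⟩

theorem exists_gt_lt_one (hF : IsContinuousCdf F) {x : ℝ} (h : F x < 1) :
    ∃ y, x < y ∧ F y < 1 := by
  have h1 : ∀ᶠ y in 𝓝[>] x, F y < 1 :=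
    (hF.cont.continuousAt.eventually_lt continuousAt_const h).filter_mono nhdsWithin_le_nhds
  obtain ⟨y, hy, hxy⟩ := (h1.and self_mem_nhdsWithin).exists
  exact ⟨y, hxy, hy⟩

/-- Replaces the filter at a possibly infinite endpoint by a real threshold, so that finite and
infinite endpoints are treated alike. -/
theorem exists_of_eventually_toRightEnd (hF : IsContinuousCdf F) {p : ℝ → Prop}
    (h : ∀ᶠ x in toRightEnd F, p x) : ∃ l, F l < 1 ∧ ∀ s, l < s → F s < 1 → p s := by
  obtain ⟨t, ht, hts⟩ := mem_comap.1 h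
  have hbot : ∃ x, F x < 1 := (hF.tendsto_atBot.eventually (gt_mem_nhds one_pos)).exists
  obtain ⟨x, hx⟩ := hbot
  obtain ⟨l', hl', hsub⟩ := (mem_nhdsLT_iff_exists_Ioo_subset' (hF.lt_rightEnd_iff.2 hx)).1 ht
  obtain ⟨l, hl1, hl2⟩ := EReal.lt_iff_exists_real_btwn.1 hl'
  refine ⟨l, hF.lt_rightEnd_iff.1 hl2, fun s hs hs1 => hts (hsub ⟨?_, hF.lt_rightEnd_iff.2 hs1⟩)⟩
  exact hl1.trans (EReal.coe_lt_coe_iff.2 hs)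

theorem exists_eq (hF : IsContinuousCdf F) {p : ℝ} (hp0 : 0 < p) (hp1 : p < 1) :
    ∃ x, F x = p := by
  obtain ⟨x, hx⟩ := (hF.tendsto_atBot.eventually (gt_mem_nhds hp0)).exists
  obtain ⟨y, hy⟩ := (hF.tendsto_atTop.eventually (lt_mem_nhds hp1)).exists
  exact mem_range_of_exists_le_of_exists_ge hF.cont ⟨x, hx.le⟩ ⟨y, hy.le⟩

/-- Points left of the infimum give ≤ in the limit, points of the set give ≥ on its closure. The
bound `2 ≤ n` keeps 1 - 1/n inside (0, 1). -/
theorem apply_centering (hF : IsContinuousCdf F) {n : ℕ} (hn : 2 ≤ n) :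
    F (centering F n) = 1 - 1 / n := by
  have hn' : (2 : ℝ) ≤ n := by exact_mod_cast hn
  have hp0 : 0 < 1 - 1 / (n : ℝ) := by
    rw [sub_pos, div_lt_one (by linarith)]; linarith
  have hp1 : 1 - 1 / (n : ℝ) < 1 := by
    have : 0 < 1 / (n : ℝ) := by positivity
    linarith
  set p := 1 - 1 / (n : ℝ) with hp
  set S := {x : ℝ | p < F x} with hS
  have hne : S.Nonempty := (hF.tendsto_atTop.eventually (lt_mem_nhds hp1)).exists
  obtain ⟨x₀, hx₀⟩ := hF.exists_eq hp0 hp1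
  have hbdd : BddBelow S := ⟨x₀, fun y hy => by
    by_contra hlt
    exact absurd (hF.mono (not_le.1 hlt).le) (not_le.2 (hx₀ ▸ hy))⟩
  refine le_antisymm ?_ ?_
  · have hev : ∀ᶠ y in 𝓝[<] (sInf S), F y ≤ p := by
      filter_upwards [self_mem_nhdsWithin] with y hy
      by_contra hlt
      exact absurd (csInf_le hbdd (not_le.1 hlt : y ∈ S)) (not_le.2 hy)
    exact le_of_tendsto ((hF.cont.tendsto (sInf S)).mono_left nhdsWithin_le_nhds) hev
  · have hmem : sInf S ∈ closure S := csInf_mem_closure hne hbdd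
    have hcl : closure S ⊆ {x | p ≤ F x} :=
      closure_minimal (fun x (hx : p < F x) => show p ≤ F x from hx.le) (isClosed_le continuous_const hF.cont)
    exact hcl hmem

theorem eventually_lt_centering (hF : IsContinuousCdf F) {l : ℝ} (hl : F l < 1) :
    ∀ᶠ n : ℕ in atTop, l < centering F n := by
  have h1 : Tendsto (fun n : ℕ => 1 - 1 / (n : ℝ)) atTop (𝓝 1) := by
    simpa using (tendsto_const_nhds (x := (1 : ℝ))).sub tendsto_one_div_atTop_nhds_zero_nat
  filter_upwards [h1.eventually (lt_mem_nhds hl), eventually_ge_atTop 2] with n hn hn2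
  by_contra hlt
  have := hF.mono (not_lt.1 hlt)
  rw [hF.apply_centering hn2] at this
  linarith

theorem centering_lt_one (hF : IsContinuousCdf F) {n : ℕ} (hn : 2 ≤ n) :
    F (centering F n) < 1 := by
  rw [hF.apply_centering hn]
  have : 0 < 1 / (n : ℝ) := by positivity
  linarith

end IsContinuousCdf

/-! ### The envelope of the von Mises function. -/

section Envelope

variable {F : ℝ → ℝ}

theorem envelope_antitone (F : ℝ → ℝ) : Antitone (envelope F) := fun _ _ hxy =>
  biSup_mono fun _ hz => ⟨hxy.trans_lt hz.1, hz.2⟩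

theorem abs_vonMisesFun_le (hF : IsContinuousCdf F) {x y : ℝ} (h : envelope F x ≠ ⊤) (hxy : x < y)
    (hy : F y < 1) : |vonMisesFun F y| ≤ (envelope F x).toReal := by
  have h1 : ENNReal.ofReal |vonMisesFun F y| ≤ envelope F x :=
    le_biSup (fun y => ENNReal.ofReal |vonMisesFun F y|)
      (show y ∈ {y : ℝ | x < y ∧ (y : EReal) < rightEnd F} from ⟨hxy, hF.lt_rightEnd_iff.2 hy⟩)
  exact (ENNReal.ofReal_le_iff_le_toReal h).1 h1

theorem exists_envelope_le (hF : IsContinuousCdf F)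
    (h : Tendsto (vonMisesFun F) (toRightEnd F) (𝓝 0)) {ε : ℝ} (hε : 0 < ε) :
    ∃ l, F l < 1 ∧ envelope F l ≤ ENNReal.ofReal ε := by
  have h1 : ∀ᶠ x in toRightEnd F, |vonMisesFun F x| ≤ ε := by
    filter_upwards [h.eventually (Metric.closedBall_mem_nhds 0 hε)] with x hx
    simpa using hx
  obtain ⟨l, hl, hl2⟩ := hF.exists_of_eventually_toRightEnd h1
  exact ⟨l, hl, iSup₂_le fun y hy =>
    ENNReal.ofReal_le_ofReal (hl2 y hy.1 (hF.lt_rightEnd_iff.1 hy.2))⟩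

theorem tendsto_envelope_centering (hF : IsContinuousCdf F)
    (h : Tendsto (vonMisesFun F) (toRightEnd F) (𝓝 0)) {ε : ℝ} (hε : 0 < ε) :
    ∀ᶠ n : ℕ in atTop, envelope F (centering F n) ≤ ENNReal.ofReal ε := by
  obtain ⟨l, hl, hl2⟩ := exists_envelope_le hF h hε
  filter_upwards [hF.eventually_lt_centering hl] with n hn
  exact (envelope_antitone F hn.le).trans hl2

end Envelope

/-! ### Regularity of η and 1/η' near the right end. -/

section Regularity

variable {F f : ℝ → ℝ}

theorem exp_neg_eta {x : ℝ} (h0 : 0 < F x) (h1 : F x < 1) :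
    Real.exp (-eta F x) = -Real.log (F x) := by
  rw [eta, neg_neg, Real.exp_log (neg_pos.2 (Real.log_neg h0 h1))]

theorem hasDerivAt_eta {x : ℝ} (h0 : 0 < F x) (h1 : F x < 1) (hd : HasDerivAt F (f x) x) :
    HasDerivAt (eta F) (f x / (F x * -Real.log (F x))) x := by
  have hlog := Real.log_neg h0 h1
  refine ((hd.log h0.ne').neg.log (neg_pos.2 hlog).ne').neg.congr_deriv ?_
  simp only [Pi.neg_apply]
  have := hlog.ne
  field_simp

theorem VonMisesCondition.exists_regular (hF : IsContinuousCdf F) (h : VonMisesCondition F f) :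
    ∃ l, F l < 1 ∧ 0 < F l ∧ ∀ s, l < s → F s < 1 → 0 < F s ∧ HasDerivAt F (f s) s ∧ 0 < f s ∧
      invEtaDeriv F s = F s * -Real.log (F s) / f s ∧ 0 < invEtaDeriv F s ∧
      HasDerivAt (eta F) (1 / invEtaDeriv F s) s ∧
      HasDerivAt (invEtaDeriv F) (vonMisesFun F s) s := by
  obtain ⟨l₀, hl₀, hreg⟩ := hF.exists_of_eventually_toRightEnd h.1
  -- Right of a median F is positive, so that both logarithms in η are genuine.
  obtain ⟨l₁, hl₁⟩ := hF.exists_eq (p := 1 / 2) (by norm_num) (by norm_num)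
  have hl0 : 0 < F (max l₀ l₁) :=
    lt_of_lt_of_le (by rw [hl₁]; norm_num) (hF.mono (le_max_right l₀ l₁))
  have hl : F (max l₀ l₁) < 1 := by
    rcases max_cases l₀ l₁ with ⟨he, -⟩ | ⟨he, -⟩ <;> rw [he]
    · exact hl₀
    · rw [hl₁]; norm_num
  have hpos : ∀ s, max l₀ l₁ < s → 0 < F s := fun s hs => hl0.trans_le (hF.mono hs.le)
  have hinv : ∀ s, max l₀ l₁ < s → F s < 1 →
      invEtaDeriv F s = F s * -Real.log (F s) / f s := fun s hs hs1 => by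
    rw [invEtaDeriv, (hasDerivAt_eta (hpos s hs) hs1
      (hreg s ((le_max_left _ _).trans_lt hs) hs1).1).deriv, one_div_div]
  refine ⟨max l₀ l₁, hl, hl0, fun s hs hs1 => ?_⟩
  obtain ⟨hd, hfd, hf⟩ := hreg s ((le_max_left _ _).trans_lt hs) hs1
  have h0 := hpos s hs
  have hlog := Real.log_neg h0 hs1
  have hv := hinv s hs hs1
  have hvpos : 0 < invEtaDeriv F s := by
    rw [hv]
    have : 0 < -Real.log (F s) := by linarith
    positivity
  refine ⟨h0, hd, hf, hv, hvpos, ?_, ?_⟩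
  · rw [hv, one_div_div]
    exact hasDerivAt_eta h0 hs1 hd
  -- The explicit formula holds on a neighbourhood of s, hence differentiability of f passes to
  -- 1/η'.
  · have hev : invEtaDeriv F =ᶠ[𝓝 s] fun s => F s * -Real.log (F s) / f s := by
      filter_upwards [lt_mem_nhds hs, hF.cont.continuousAt.eventually_lt continuousAt_const hs1]
        with y hy hy1 using hinv y hy hy1
    have hdiff : DifferentiableAt ℝ (fun s => F s * -Real.log (F s) / f s) s :=
      ((hd.differentiableAt.mul (hd.differentiableAt.log h0.ne').neg).div hfd hf.ne')
    exact (hev.differentiableAt_iff.2 hdiff).hasDerivAt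

end Regularity

/-! ### Positivity of the mean excess at a finite endpoint. -/

section MeanExcess

variable {F f : ℝ → ℝ}

theorem meanExcess_pos_of_eq_one (hF : IsContinuousCdf F) {x₀ t : ℝ} (hx₀ : F x₀ = 1)
    (ht : F t < 1) : 0 < meanExcess F t := by
  refine div_pos ?_ (by linarith)
  -- The integrand vanishes beyond `x₀`; without integrability the integral would take the default
  -- value 0.
  have hint : IntegrableOn (fun s => 1 - F s) (Set.Ioi t) := by
    have hc : Continuous fun s => 1 - F s := continuous_const.sub hF.cont
    have hsub : Set.Ioi t ⊆ Set.Icc t x₀ ∪ Set.Ioi x₀ := fun s hs => by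
      rcases le_or_gt s x₀ with h | h
      · exact Or.inl ⟨le_of_lt hs, h⟩
      · exact Or.inr h
    refine IntegrableOn.mono_set (IntegrableOn.union hc.continuousOn.integrableOn_Icc ?_) hsub
    refine integrableOn_zero.congr_fun (fun s hs => ?_) measurableSet_Ioi
    have : F s = 1 := le_antisymm (hF.le_one s) (hx₀ ▸ hF.mono (le_of_lt hs))
    simp [this]
  rw [setIntegral_pos_iff_support_of_nonneg_ae
    (ae_of_all _ fun s => sub_nonneg.2 (hF.le_one s)) hint]
  obtain ⟨y, hy, hy1⟩ := hF.exists_gt_lt_one ht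
  refine lt_of_lt_of_le ?_ (measure_mono (show Set.Ioo t y ⊆ _ from fun s hs =>
    ⟨(sub_pos.2 ((hF.mono hs.2.le).trans_lt hy1)).ne', hs.1⟩))
  simpa using hy

end MeanExcess

end GumbelRate

/-! ### The regular tail: norming constants and exact form of the density. -/

namespace GumbelRate

/-- On `(l, ∞)` the distribution function `F` lies in `(0, 1)`, has positive derivative `f`, and
`1 / η'` is differentiable with derivative bounded by `1 / 8`. -/
structure RegularTail (F f : ℝ → ℝ) (l : ℝ) : Prop where
  pos : ∀ s, l < s → 0 < F s
  lt_one : ∀ s, F s < 1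
  hasDerivAt : ∀ s, l < s → HasDerivAt F (f s) s
  mul_eq : ∀ s, l < s → invEtaDeriv F s * f s = F s * -Real.log (F s)
  aux : IsAuxiliary (eta F) (invEtaDeriv F) (vonMisesFun F) l
  abs_vonMises_le : ∀ s, l < s → |vonMisesFun F s| ≤ 1 / 8

namespace RegularTail

variable {F f : ℝ → ℝ} {l : ℝ}

theorem mono (h : RegularTail F f l) {l' : ℝ} (hl : l ≤ l') : RegularTail F f l' :=
  ⟨fun s hs => h.pos s (hl.trans_lt hs), h.lt_one, fun s hs => h.hasDerivAt s (hl.trans_lt hs),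
    fun s hs => h.mul_eq s (hl.trans_lt hs), h.aux.mono hl, fun s hs => h.abs_vonMises_le s (hl.trans_lt hs)⟩

theorem exp_neg_eta (h : RegularTail F f l) {s : ℝ} (hs : l < s) :
    Real.exp (-eta F s) = -Real.log (F s) :=
  GumbelRate.exp_neg_eta (h.pos s hs) (h.lt_one s)

theorem eq_exp (h : RegularTail F f l) {s : ℝ} (hs : l < s) :
    F s = Real.exp (-Real.exp (-eta F s)) := by
  rw [h.exp_neg_eta hs, neg_neg, Real.exp_log (h.pos s hs)]

theorem tendsto_exp_neg_eta (h : RegularTail F f l) (hF : IsContinuousCdf F) :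
    Tendsto (fun s => Real.exp (-eta F s)) atTop (𝓝 0) := by
  have h1 : Tendsto (fun s => -Real.log (F s)) atTop (𝓝 0) := by
    simpa using (hF.tendsto_atTop.log one_ne_zero).neg
  refine h1.congr' ?_
  filter_upwards [eventually_gt_atTop l] with s hs
  rw [h.exp_neg_eta hs]

/-- The boundary term at infinity when (v(1 - F))' is integrated: v grows at most like exp(η/2),
while 1 - F ≤ exp(-η). -/
theorem tendsto_aux_mul (h : RegularTail F f l) (hF : IsContinuousCdf F) :
    Tendsto (fun s => invEtaDeriv F s * (1 - F s)) atTop (𝓝 0) := by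
  obtain ⟨C, hC, hCv⟩ := h.aux.exists_le_exp_half h.abs_vonMises_le
  have h2 : Tendsto (fun s => C * √(Real.exp (-eta F s))) atTop (𝓝 0) := by
    simpa using ((h.tendsto_exp_neg_eta hF).sqrt).const_mul C
  refine squeeze_zero' ?_ ?_ h2
  · filter_upwards [eventually_gt_atTop l] with s hs
    exact mul_nonneg (h.aux.pos s hs).le (sub_nonneg.2 (h.lt_one s).le)
  · filter_upwards [eventually_ge_atTop (l + 1)] with s hs
    have hs' : l < s := by linarith
    have h3 : 1 - F s ≤ Real.exp (-eta F s) := by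
      have := Real.add_one_le_exp (-Real.exp (-eta F s))
      rw [← h.eq_exp hs'] at this
      linarith
    have hsq : √(Real.exp (-eta F s)) = Real.exp (-eta F s / 2) := by
      rw [Real.exp_half]
    calc invEtaDeriv F s * (1 - F s)
        ≤ (C * Real.exp (eta F s / 2)) * Real.exp (-eta F s) := by
          refine mul_le_mul (hCv s hs) h3 (sub_nonneg.2 (h.lt_one s).le) (by positivity)
      _ = C * √(Real.exp (-eta F s)) := by
          rw [hsq, mul_assoc, ← Real.exp_add]; ring_nf

/-- With y = exp(-η) and F = exp(-y), this says that v f = yF differs from 1 - F by at most y(1 -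
F). -/
theorem one_sub_sub_bounds (y : ℝ) :
    0 ≤ 1 - Real.exp (-y) - y * Real.exp (-y) ∧
      1 - Real.exp (-y) - y * Real.exp (-y) ≤ y * (1 - Real.exp (-y)) := by
  have h1 := Real.add_one_le_exp y
  have h2 := Real.add_one_le_exp (-y)
  have h3 : Real.exp y * Real.exp (-y) = 1 := by rw [← Real.exp_add]; simp
  have h4 := Real.exp_pos (-y)
  constructor <;> nlinarith

/-- The mean excess function is close to `1 / η'`. -/
theorem abs_div_meanExcess_sub_one_le (h : RegularTail F f l) (hF : IsContinuousCdf F) {b H : ℝ}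
    (hb : l < b) (hw : ∀ s, b < s → |vonMisesFun F s| ≤ H)
    (hθ : H + Real.exp (-eta F b) ≤ 1 / 2) :
    0 < meanExcess F b ∧
      |invEtaDeriv F b / meanExcess F b - 1| ≤ H + Real.exp (-eta F b) := by
  set θ := H + Real.exp (-eta F b) with hθd
  set v := invEtaDeriv F with hv
  set g' : ℝ → ℝ := fun s => vonMisesFun F s * (1 - F s) - v s * f s with hg'
  have hderiv : ∀ s, l < s → HasDerivAt (fun s => v s * (1 - F s)) (g' s) s := fun s hs => by
    refine ((h.aux.hasDerivAt_aux s hs).mul ((h.hasDerivAt s hs).const_sub 1)).congr_deriv ?_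
    simp only [hg']
    ring
  have hbar : ∀ s, 0 < 1 - F s := fun s => sub_pos.2 (h.lt_one s)
  -- (v(1 - F))' equals -(1 - F) up to a factor 1 + O(θ); integrating over (b, ∞) compares v(b)(1 -
  -- F(b)) with the integral of 1 - F.
  have hclose : ∀ s, b < s → |g' s + (1 - F s)| ≤ θ * (1 - F s) := by
    intro s hs
    have hls := hb.trans hs
    have hyb : Real.exp (-eta F s) ≤ Real.exp (-eta F b) := by
      have := h.aux.monotoneOn_eta hb hls hs.le
      gcongr
    obtain ⟨h1, h2⟩ := one_sub_sub_bounds (Real.exp (-eta F s))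
    have h3 : v s * f s = Real.exp (-eta F s) * F s := by
      rw [h.mul_eq s hls, h.exp_neg_eta hls]; ring
    rw [← h.eq_exp hls] at h1 h2
    have h4 := hw s hs
    have h5 : |vonMisesFun F s * (1 - F s)| ≤ H * (1 - F s) := by
      rw [abs_mul, abs_of_pos (hbar s)]
      exact mul_le_mul_of_nonneg_right h4 (hbar s).le
    have h6 : Real.exp (-eta F s) * (1 - F s) ≤ Real.exp (-eta F b) * (1 - F s) :=
      mul_le_mul_of_nonneg_right hyb (hbar s).le
    simp only [hg', h3, hθd]
    rw [abs_le] at h5 ⊢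
    constructor <;> nlinarith [h5.1, h5.2]
  -- Since θ ≤ 1/2, the integrable function -g' dominates (1 - F)/2; this is where integrability of
  -- 1 - F comes from.
  have hneg : ∀ s, b < s → 1 - F s ≤ 2 * -g' s := by
    intro s hs
    have h1 := (abs_le.1 (hclose s hs)).2
    have h2 := mul_le_mul_of_nonneg_right hθ (hbar s).le
    linarith
  have hcont : ContinuousWithinAt (fun s => v s * (1 - F s)) (Set.Ici b) b :=
    (hderiv b hb).continuousAt.continuousWithinAt
  have hnonpos : ∀ s ∈ Set.Ioi b, g' s ≤ 0 := fun s hs => by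
    have := hneg s hs
    have := hbar s
    linarith
  have hint := integrableOn_Ioi_deriv_of_nonpos hcont (fun s hs => hderiv s (hb.trans hs)) hnonpos
    (h.tendsto_aux_mul hF)
  have hval := integral_Ioi_of_hasDerivAt_of_nonpos hcont (fun s hs => hderiv s (hb.trans hs))
    hnonpos (h.tendsto_aux_mul hF)
  have hintF : IntegrableOn (fun s => 1 - F s) (Set.Ioi b) := by
    refine Integrable.mono' (hint.neg.const_mul 2)
      (continuous_const.sub hF.cont).aestronglyMeasurable ?_
    refine (ae_restrict_iff' measurableSet_Ioi).2 (ae_of_all _ fun s hs => ?_)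
    rw [Real.norm_eq_abs, abs_of_pos (hbar s)]
    exact hneg s hs
  set I := ∫ s in Set.Ioi b, (1 - F s) with hI
  have hdiff : |I - v b * (1 - F b)| ≤ θ * I := by
    have h1 : I - v b * (1 - F b) = ∫ s in Set.Ioi b, (g' s + (1 - F s)) := by
      rw [integral_add hint hintF, hval]; ring
    rw [h1, hI, ← integral_const_mul]
    refine (abs_integral_le_integral_abs).trans ?_
    exact setIntegral_mono_on (hint.add hintF).abs (hintF.const_mul θ) measurableSet_Ioi hclose
  have hvb := h.aux.pos b hb
  have hvF : 0 < v b * (1 - F b) := mul_pos hvb (hbar b)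
  have hI0 : 0 ≤ I := setIntegral_nonneg measurableSet_Ioi fun s _ => (hbar s).le
  have hIpos : 0 < I := by
    rcases hI0.eq_or_lt with h0 | h0
    · rw [← h0] at hdiff
      have := (abs_le.1 hdiff).1
      linarith
    · exact h0
  refine ⟨div_pos hIpos (hbar b), ?_⟩
  have hb0 := hbar b
  have : v b / meanExcess F b - 1 = -(I - v b * (1 - F b)) / I := by
    rw [meanExcess, ← hI]
    field_simp
    ring
  rw [this, abs_div, abs_neg, abs_of_pos hIpos, div_le_iff₀ hIpos]
  exact hdiff

/-- Inverting the ratio of `abs_div_meanExcess_sub_one_le` costs the factor 2; for u = 1/η' the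
ratio is exactly 1. -/
theorem abs_aux_div_sub_one_le (h : RegularTail F f l) (hF : IsContinuousCdf F) {b H : ℝ}
    {u : ℝ → ℝ} (hu : u = meanExcess F ∨ u = invEtaDeriv F) (hH : 0 ≤ H)
    (hb : l < b) (hw : ∀ s, b < s → |vonMisesFun F s| ≤ H)
    (hθ : H + Real.exp (-eta F b) ≤ 1 / 4) :
    0 < u b ∧ |u b / invEtaDeriv F b - 1| ≤ 2 * (H + Real.exp (-eta F b)) := by
  have hvb := h.aux.pos b hb
  have hy := Real.exp_pos (-eta F b)
  rcases hu with rfl | rfl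
  · obtain ⟨h1, h2⟩ := h.abs_div_meanExcess_sub_one_le hF hb hw (by linarith)
    refine ⟨h1, ?_⟩
    set m := meanExcess F b
    set v := invEtaDeriv F b
    set θ := H + Real.exp (-eta F b)
    rw [show v / m - 1 = (v - m) / m by field_simp, abs_div, abs_of_pos h1, div_le_iff₀ h1] at h2
    rw [show m / v - 1 = -(v - m) / v by field_simp; ring, abs_div, abs_neg, abs_of_pos hvb,
      div_le_iff₀ hvb]
    have h3 := (abs_le.1 h2).1
    have h4 : m ≤ 2 * v := by nlinarith
    have h5 : 0 ≤ θ := by positivity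
    nlinarith
  · refine ⟨hvb, ?_⟩
    rw [div_self hvb.ne', sub_self, abs_zero]
    positivity

/-- The density of the normalized maximum as a perturbed Gumbel density. -/
theorem maxDensity_eq (h : RegularTail F f l) {b ρ x : ℝ} {n : ℕ} (hn : n ≠ 0) (hb : l < b)
    (hz : l < ρ * invEtaDeriv F b * x + b) :
    maxDensity F f (ρ * invEtaDeriv F b) b n x =
      ρ * (invEtaDeriv F b / invEtaDeriv F (ρ * invEtaDeriv F b * x + b)) *
        gumbelDensity (eta F (ρ * invEtaDeriv F b * x + b) - eta F b -
          Real.log (n * Real.exp (-eta F b))) := by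
  set z := ρ * invEtaDeriv F b * x + b with hzd
  have hn' : (0 : ℝ) < n := by exact_mod_cast Nat.pos_of_ne_zero hn
  have hvb := h.aux.pos b hb
  have hvz := h.aux.pos z hz
  rw [gumbelDensity_sub_log (by positivity)]
  have h1 : n * Real.exp (-eta F b) * Real.exp (-(eta F z - eta F b)) =
      n * -Real.log (F z) := by
    rw [mul_assoc, ← Real.exp_add, ← h.exp_neg_eta hz]
    ring_nf
  rw [h1]
  have h2 : Real.exp (-(n * -Real.log (F z))) = F z ^ n := by
    rw [show -((n : ℝ) * -Real.log (F z)) = n * Real.log (F z) by ring, Real.exp_nat_mul,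
      Real.exp_log (h.pos z hz)]
  have h3 := h.mul_eq z hz
  obtain ⟨m, rfl⟩ := Nat.exists_eq_succ_of_ne_zero hn
  rw [h2, maxDensity, ← hzd, Nat.succ_sub_one, pow_succ]
  field_simp
  linear_combination ρ * F z ^ m * h3

/-- Bounds κ = -n log(1 - 1/n): from below by exp(-y) ≥ 1 - y, from above by (n - 1)y ≤ 1, where y =
exp(-η(b)). -/
theorem mul_exp_neg_eta_bounds (h : RegularTail F f l) {b : ℝ} {n : ℕ} (hn : n ≠ 0) (hb : l < b)
    (hFb : F b = 1 - 1 / n) :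
    1 ≤ n * Real.exp (-eta F b) ∧
      n * Real.exp (-eta F b) - 1 ≤ Real.exp (-eta F b) := by
  have hn' : (0 : ℝ) < n := by exact_mod_cast Nat.pos_of_ne_zero hn
  set y := Real.exp (-eta F b) with hy
  have hy0 : 0 < y := Real.exp_pos _
  have h1 : Real.exp (-y) = 1 - 1 / n := by rw [← hFb, h.eq_exp hb]
  obtain ⟨h2, h3⟩ := one_sub_sub_bounds y
  rw [h1] at h2 h3
  have h4 := Real.add_one_le_exp (-y)
  rw [h1] at h4
  have h5 : (n : ℝ) * (1 / n) = 1 := by field_simp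
  constructor
  · nlinarith
  · have : 0 ≤ n * (1 - (1 - 1 / (n : ℝ)) - y * (1 - 1 / n)) := by positivity
    nlinarith

end RegularTail

end GumbelRate

/-! ### The uniform bound when r(F) = ∞. -/

namespace GumbelRate

variable {F f : ℝ → ℝ}

theorem gumbelDensity_far_le {ρ x X : ℝ} (hX : 0 < X) (hρ : |ρ - 1| ≤ 1 / 2) (hx : X ≤ |ρ * x|) :
    gumbelDensity x ≤ 3 / X := by
  have hρ' := abs_le.1 hρ
  rw [abs_mul, abs_of_pos (by linarith : 0 < ρ)] at hx
  have hx1 : 2 / 3 * X ≤ |x| := by nlinarith [abs_nonneg x]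
  have h1 := pow_mul_exp_neg_le 1 (abs_nonneg x)
  norm_num at h1
  have hx0 : 0 < |x| := by linarith
  rw [le_div_iff₀ hX]
  have h2 := gumbelDensity_le x
  have h3 := Real.exp_pos (-|x|)
  nlinarith

namespace RegularTail

variable {l : ℝ}

/-- Uniform bound for the density of the normalized maximum on the regular tail of `F`. -/
theorem abs_maxDensity_sub_le (h : RegularTail F f l) {b ρ x δ D A H : ℝ} {n : ℕ} (hn : n ≠ 0)
    (hb : l < b) (hFb : F b = 1 - 1 / n) (hH : 0 < H) (hδ : 0 < δ) (hD : 0 ≤ D) (hA : 0 ≤ A)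
    (hw : ∀ s, b - invEtaDeriv F b * (δ / H) ≤ s → |vonMisesFun F s| ≤ D * H)
    (hl : l < b - invEtaDeriv F b * (δ / H)) (hDδ : D * δ ≤ 1 / 2) (hρ : |ρ - 1| ≤ A * H)
    (hρ2 : |ρ - 1| ≤ 1 / 2) (hy : Real.exp (-eta F b) ≤ A * H) (hy1 : Real.exp (-eta F b) ≤ 1)
    (hz : l < ρ * invEtaDeriv F b * x + b) :
    |maxDensity F f (ρ * invEtaDeriv F b) b n x - gumbelDensity x| ≤
      (128 * (2 * D + A) + 27 / δ) * H := by
  have hρ' := abs_le.1 hρ2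
  have hρ0 : 0 < ρ := by linarith
  have hvb := h.aux.pos b hb
  obtain ⟨hκ1, hκ2⟩ := h.mul_exp_neg_eta_bounds hn hb hFb
  have hX : 0 < δ / H := by positivity
  have hDX : D * H * (δ / H) ≤ 1 / 2 := by
    rwa [show D * H * (δ / H) = D * δ by field_simp]
  rw [h.maxDensity_eq hn hb hz]
  set z := ρ * invEtaDeriv F b * x + b with hzd
  have hvz := h.aux.pos z hz
  have hzx : (z - b) / invEtaDeriv F b = ρ * x := by rw [hzd]; field_simp; ring
  rcases le_or_gt |ρ * x| (δ / H) with hx | hx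
  -- Inside the window: the perturbation estimate is applied at ρx = (z - b)/v(b), so its reference
  -- point x/ρ becomes the original x.
  · have hsub : ∀ s ∈ Set.uIcc b z, |vonMisesFun F s| ≤ D * H := fun s hs => by
      refine hw s (le_trans (le_min ?_ ?_) hs.1)
      · have : 0 < invEtaDeriv F b * (δ / H) := by positivity
        linarith
      · have := (abs_le.1 hx).1
        rw [hzd]
        nlinarith
    have hDx : D * H * |(z - b) / invEtaDeriv F b| ≤ 1 / 2 := by
      rw [hzx]; exact (mul_le_mul_of_nonneg_left hx (by positivity)).trans hDX
    obtain ⟨hq1, -, hq3⟩ := h.aux.ratio_near hb hz hsub hDx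
    obtain ⟨r, hr, hr1, hr2⟩ := h.aux.eta_near hb hz (by positivity) hsub hDx
    rw [hzx] at hq1 hr hr1
    have hle : 2 * (D * H) ≤ (2 * D + A) * H := by nlinarith
    have hle2 : A * H ≤ (2 * D + A) * H := by nlinarith
    have := abs_perturbed_gumbelDensity_sub_le (A := (2 * D + A) * H) (x := ρ * x) (r := r)
      (q := invEtaDeriv F b / invEtaDeriv F z) (ρ := ρ) (κ := n * Real.exp (-eta F b))
      (by positivity) (hr1.trans (by gcongr)) (hq1.trans (by gcongr)) hr2 (by positivity) hq3
      (hρ.trans hle2) hρ2 hκ1 (hκ2.trans (hy.trans hle2)) (by linarith)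
    rw [mul_div_cancel_left₀ _ hρ0.ne', ← hr] at this
    refine this.trans ?_
    have : 0 ≤ 27 / δ * H := by positivity
    linarith
  -- Outside the window both densities are bounded separately: the ratio of v costs at most
  -- exp(|t|/2) against the decay exp(-|t|), and |t| ≥ δ/(2H). The constants 24 and 3 add up to 27.
  · have ht := h.aux.eta_far hb hz (by positivity) hX.le hw hl hDX (by rw [hzx]; exact hx.le)
    set t := eta F z - eta F b with htd
    have hφ := gumbelDensity_far_le hX hρ2 hx.le
    have hq := h.aux.le_mul_exp hb hz h.abs_vonMises_le
    rw [← htd] at hq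
    have hg1 := gumbelDensity_sub_log_le hκ1 (by linarith) t
    have hg : ρ * (invEtaDeriv F b / invEtaDeriv F z) *
        gumbelDensity (t - Real.log (n * Real.exp (-eta F b))) ≤ 24 / (δ / H) := by
      have hq' : invEtaDeriv F b / invEtaDeriv F z ≤ Real.exp (|t| / 2) := by
        rw [div_le_iff₀ hvz, mul_comm]
        refine hq.trans ?_
        gcongr
        linarith [abs_nonneg t]
      have he := mul_exp_neg_half_le (abs_nonneg t)
      calc _ ≤ (3 / 2 * Real.exp (|t| / 2)) * (4 * Real.exp (-|t|)) := by
            refine mul_le_mul (mul_le_mul (by linarith) hq' (by positivity) (by norm_num)) hg1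
              (gumbelDensity_nonneg _) (by positivity)
        _ = 6 * (Real.exp (|t| / 2) * Real.exp (-|t|)) := by ring
        _ = 6 * Real.exp (-|t| / 2) := by rw [← Real.exp_add]; ring_nf
        _ ≤ 24 / (δ / H) := by
            rw [le_div_iff₀ hX]
            have := Real.exp_pos (-|t| / 2)
            nlinarith
    have hg0 : 0 ≤ ρ * (invEtaDeriv F b / invEtaDeriv F z) *
        gumbelDensity (t - Real.log (n * Real.exp (-eta F b))) :=
      mul_nonneg (by positivity) (gumbelDensity_nonneg _)
    have hφ0 := gumbelDensity_nonneg x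
    have e1 : 24 / (δ / H) = 24 / δ * H := by field_simp
    have e2 : 3 / (δ / H) = 3 / δ * H := by field_simp
    have e3 : (128 * (2 * D + A) + 27 / δ) * H =
      128 * (2 * D + A) * H + 24 / δ * H + 3 / δ * H := by field_simp; ring
    have e4 : 0 ≤ 128 * (2 * D + A) * H := by positivity
    rw [e3, abs_le]
    have e5 : 0 ≤ 24 / δ * H := by positivity
    have e6 : 0 ≤ 3 / δ * H := by positivity
    constructor <;> linarith

end RegularTail

theorem VonMisesCondition.exists_regularTail (hF : IsContinuousCdf F) (h : VonMisesCondition F f)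
    (hF1 : ∀ x, F x < 1) : ∃ l, RegularTail F f l := by
  obtain ⟨l₀, -, -, hreg⟩ := h.exists_regular hF
  obtain ⟨l₁, -, hl₁⟩ := exists_envelope_le hF h.2 (ε := 1 / 8) (by norm_num)
  refine ⟨max l₀ l₁, ?_⟩
  have hr := fun s (hs : max l₀ l₁ < s) => hreg s ((le_max_left _ _).trans_lt hs) (hF1 s)
  refine ⟨fun s hs => (hr s hs).1, hF1, fun s hs => (hr s hs).2.1, fun s hs => ?_, ⟨fun s hs =>
    (hr s hs).2.2.2.2.1, fun s hs => (hr s hs).2.2.2.2.2.1, fun s hs => (hr s hs).2.2.2.2.2.2⟩,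
    fun s hs => ?_⟩
  · obtain ⟨-, -, hf, hv, -⟩ := hr s hs
    rw [hv]
    field_simp
  · have htop : envelope F l₁ ≠ ⊤ := (hl₁.trans_lt ENNReal.ofReal_lt_top).ne
    exact (abs_vonMisesFun_le hF htop ((le_max_right _ _).trans_lt hs) (hF1 s)).trans
      (ENNReal.toReal_le_of_le_ofReal (by norm_num) hl₁)

/-- One power of n is the prefactor of the density, one comes from v ≤ C n, and the third makes the
resulting bound 1/n. -/
theorem eventually_mul_pow_le {q : ℝ} (hq0 : 0 < q) (hq1 : q < 1) (C : ℝ) :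
    ∀ᶠ n : ℕ in atTop, C * n ^ 3 * q ^ (n - 1) ≤ 1 := by
  have h := (tendsto_pow_const_mul_const_pow_of_lt_one 3 hq0.le hq1).const_mul (C / q)
  rw [mul_zero] at h
  filter_upwards [h.eventually (ge_mem_nhds one_pos), eventually_ne_atTop 0] with n hn hn0
  obtain ⟨m, rfl⟩ := Nat.exists_eq_succ_of_ne_zero hn0
  rw [Nat.succ_sub_one]
  refine le_trans (le_of_eq ?_) hn
  rw [pow_succ q]
  field_simp

theorem exp_half_le {η N : ℝ} (hη : Real.exp (-η) ≤ 1) (hN : 1 ≤ N * Real.exp (-η)) :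
    Real.exp (η / 2) ≤ N := by
  have hη0 : 0 ≤ η := by
    have := Real.exp_le_one_iff.1 hη
    linarith
  calc Real.exp (η / 2) ≤ Real.exp η := by gcongr; linarith
    _ ≤ N * Real.exp (-η) * Real.exp η := le_mul_of_one_le_left (Real.exp_pos _).le hN
    _ = N := by rw [mul_assoc, ← Real.exp_add]; simp

theorem maxDensity_mul_bounds (hF : IsContinuousCdf F) (hf0 : ∀ x, 0 ≤ f x) {M : ℝ}
    (hM : ∀ x, f x ≤ M) {ρ v b x C L : ℝ} {n : ℕ} (hρ0 : 0 ≤ ρ) (hρ : ρ ≤ 3 / 2) (hv0 : 0 ≤ v)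
    (hC : 0 ≤ C) (hv : v ≤ C * n) (hx : ρ * v * x + b ≤ L) :
    0 ≤ maxDensity F f (ρ * v) b n x ∧
      maxDensity F f (ρ * v) b n x * n ≤ 3 / 2 * C * M * n ^ 3 * F L ^ (n - 1) := by
  have hFz : 0 ≤ F (ρ * v * x + b) := hF.mono.le_of_tendsto hF.tendsto_atBot _
  have hfz := hf0 (ρ * v * x + b)
  have hMz := hM (ρ * v * x + b)
  have hFL := hF.mono hx
  unfold maxDensity
  refine ⟨by positivity, ?_⟩
  have hM0 : 0 ≤ M := hfz.trans hMz
  calc _ ≤ n * (3 / 2 * (C * n)) * M * F L ^ (n - 1) * n := by gcongr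
    _ = _ := by ring

set_option maxHeartbeats 800000 in
/-- Uniform rate of convergence for the density of the normalized maximum, when `r(F) = ∞`. -/
theorem exists_uniform_bound (hF : IsContinuousCdf F) (hvM : VonMisesCondition F f)
    (hF1 : ∀ x, F x < 1) (hf0 : ∀ x, 0 ≤ f x) {M : ℝ} (hM : ∀ x, f x ≤ M) {u : ℝ → ℝ}
    (hu : u = meanExcess F ∨ u = invEtaDeriv F) {b : ℕ → ℝ} (hb : ∀ n, b n = centering F n)
    {k γ D : ℝ} (hk : 0 < k) (hγ0 : 0 < γ) (hγ1 : γ < 1)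
    (h1 : ∀ᶠ n in atTop, 0 < b n ∧ u (b n) ≤ k * (b n * (envelope F (b n)).toReal))
    (h2 : ∀ᶠ n in atTop, envelope F (b n * (1 - γ)) ≤ ENNReal.ofReal D * envelope F (b n)) :
    ∃ C, ∀ᶠ n in atTop, 0 < u (b n) ∧ 0 < (envelope F (b n)).toReal ∧
      ∀ x, |maxDensity F f (u (b n)) (b n) n x - gumbelDensity x| ≤
        C * (envelope F (b n)).toReal := by
  obtain ⟨l, hreg⟩ := hvM.exists_regularTail hF hF1
  obtain ⟨C₁, hC₁, hv₁⟩ := hreg.aux.exists_le_exp_half hreg.abs_vonMises_le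
  obtain ⟨C₂, l₂, hC₂, -, hv₂⟩ := hreg.aux.exists_exp_neg_le hreg.abs_vonMises_le
  set L := max (l + 1) l₂ with hL
  have hlL : l < L := lt_of_lt_of_le (by linarith) (le_max_left _ _)
  have hT : RegularTail F f L := hreg.mono hlL.le
  obtain ⟨S, hS⟩ := eventually_atTop.1
    ((hT.tendsto_exp_neg_eta hF).eventually (ge_mem_nhds (show (0 : ℝ) < 1 / 8 by norm_num)))
  set E := max D 1 with hE
  have hE1 : 1 ≤ E := le_max_right _ _
  set A := 2 * (1 + 2 * k * C₂) with hA
  have hA0 : 0 ≤ A := by positivity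
  -- The first entry keeps the window above B(1 - γ/2), where the second growth condition applies;
  -- the second keeps the relative change of v in it below 1/2.
  set δ := min (γ / (4 * k)) (1 / (2 * E)) with hδd
  have hδ : 0 < δ := lt_min (by positivity) (by positivity)
  have hδ1 : 2 * k * δ ≤ γ / 2 := by
    have := min_le_left (γ / (4 * k)) (1 / (2 * E))
    rw [← hδd, le_div_iff₀ (by positivity)] at this
    linarith
  have hδ2 : E * δ ≤ 1 / 2 := by
    have := min_le_right (γ / (4 * k)) (1 / (2 * E))
    rw [← hδd, le_div_iff₀ (by positivity)] at this
    linarith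
  have hM0 : 0 ≤ M := (hf0 0).trans (hM 0)
  refine ⟨128 * (2 * E + A) + 27 / δ + A + 3 / δ, ?_⟩
  filter_upwards [h1, h2, hF.eventually_lt_centering (hF1 L), hF.eventually_lt_centering (hF1 S),
    hF.eventually_lt_centering (hF1 (L / (1 - γ / 2))),
    tendsto_envelope_centering hF hvM.2 (ε := 1 / 8) (by norm_num), eventually_ge_atTop 2,
    eventually_mul_pow_le (hreg.pos L hlL) (hF1 L) (3 / 2 * C₁ * M)]
    with n hn1 hn2 hLb hSb hLb' henv hn hpow
  rw [← hb n] at hLb hSb hLb' henv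
  have hFb : F (b n) = 1 - 1 / n := by rw [hb n]; exact hF.apply_centering hn
  set B := b n with hBd
  obtain ⟨hB, hu1⟩ := hn1
  have hn0 : n ≠ 0 := by omega
  have hnpos : (0 : ℝ) < n := by exact_mod_cast Nat.pos_of_ne_zero hn0
  have htop : envelope F B ≠ ⊤ := (henv.trans_lt ENNReal.ofReal_lt_top).ne
  have hH8 : (envelope F B).toReal ≤ 1 / 8 := ENNReal.toReal_le_of_le_ofReal (by norm_num) henv
  have hH0 : 0 ≤ (envelope F B).toReal := ENNReal.toReal_nonneg
  have hwB : ∀ s, B < s → |vonMisesFun F s| ≤ (envelope F B).toReal := fun s hs =>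
    abs_vonMisesFun_le hF htop hs (hF1 s)
  have hγtop : envelope F (B * (1 - γ)) ≠ ⊤ :=
    (hn2.trans_lt (ENNReal.mul_lt_top ENNReal.ofReal_lt_top htop.lt_top)).ne
  have hwγ : ∀ s, B * (1 - γ) < s → |vonMisesFun F s| ≤ E * (envelope F B).toReal := by
    intro s hs
    refine (abs_vonMisesFun_le hF hγtop hs (hF1 s)).trans ?_
    have h3 := ENNReal.toReal_mono (ENNReal.mul_ne_top ENNReal.ofReal_ne_top htop) hn2
    rw [ENNReal.toReal_mul] at h3
    refine h3.trans (mul_le_mul_of_nonneg_right ?_ hH0)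
    rw [ENNReal.toReal_ofReal']
    exact max_le_max_left D zero_le_one
  set H := (envelope F B).toReal with hHd
  have hy8 : Real.exp (-eta F B) ≤ 1 / 8 := hS B hSb.le
  obtain ⟨hu0, hρ⟩ := hT.abs_aux_div_sub_one_le hF hu hH0 hLb hwB (by linarith)
  have hv := hT.aux.pos B hLb
  set v := invEtaDeriv F B with hvd
  set ρ := u B / v with hρd
  have huρ : u B = ρ * v := by rw [hρd]; field_simp
  have hρ2 : |ρ - 1| ≤ 1 / 2 := by linarith
  have hρ' := abs_le.1 hρ2
  have hvB : v ≤ 2 * k * (B * H) := by nlinarith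
  -- H = 0 would force v ≤ 0.
  have hH : 0 < H := by
    rcases hH0.eq_or_lt with h0 | h0
    · rw [← h0] at hvB
      linarith
    · exact h0
  have hyH : Real.exp (-eta F B) ≤ 2 * k * C₂ * H := by
    refine (hv₂ B ((le_max_right _ _).trans_lt hLb)).trans ?_
    calc C₂ * (v / B) ≤ C₂ * (2 * k * (B * H) / B) := by gcongr
      _ = 2 * k * C₂ * H := by field_simp
  have hyA : Real.exp (-eta F B) ≤ A * H := by
    refine hyH.trans (mul_le_mul_of_nonneg_right ?_ hH0)
    have : 0 ≤ 2 * k * C₂ := by positivity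
    rw [hA]
    linarith
  have hρA : |ρ - 1| ≤ A * H := by
    refine hρ.trans ?_
    rw [hA]
    linarith
  have hwin : v * (δ / H) ≤ γ / 2 * B := by
    calc v * (δ / H) ≤ 2 * k * (B * H) * (δ / H) := by gcongr
      _ = 2 * k * δ * B := by field_simp
      _ ≤ γ / 2 * B := by gcongr
  have hLwin : L < B - v * (δ / H) := by
    rw [div_lt_iff₀ (by linarith)] at hLb'
    linarith
  have hwwin : ∀ s, B - v * (δ / H) ≤ s → |vonMisesFun F s| ≤ E * H := fun s hs =>
    hwγ s (by nlinarith)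
  refine ⟨hu0, hH, fun x => ?_⟩
  rw [huρ]
  have hrest : 0 ≤ A * H + 3 / δ * H := by positivity
  rcases lt_or_ge L (ρ * v * x + B) with hz | hz
  · refine (hT.abs_maxDensity_sub_le hn0 hLb hFb hH hδ (by linarith) hA0 hwwin hLwin hδ2 hρA hρ2 hyA
      (by linarith) hz).trans ?_
    linarith
  -- The window lies right of L, so z ≤ L puts x outside it and λ(x) is O(H).
  · have hx : δ / H ≤ |ρ * x| := by
      rw [le_abs]
      right
      have : v * (δ / H) ≤ v * -(ρ * x) := by nlinarith
      exact le_of_mul_le_mul_left this hv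
    have hφ := gumbelDensity_far_le (by positivity) hρ2 hx
    have e2 : 3 / (δ / H) = 3 / δ * H := by field_simp
    rw [e2] at hφ
    have hφ0 := gumbelDensity_nonneg x
    have hny := (hT.mul_exp_neg_eta_bounds hn0 hLb hFb).1
    have hvn : v ≤ C₁ * n := (hv₁ B ((le_max_left _ _).trans hLb.le)).trans
      (mul_le_mul_of_nonneg_left (exp_half_le (by linarith) hny) hC₁)
    obtain ⟨hg0, hg⟩ := maxDensity_mul_bounds hF hf0 hM (n := n) (by linarith) (by linarith) hv.le
      hC₁ hvn hz
    -- The geometric bound gives g_n ≤ 1/n, and 1/n ≤ exp(-η(B)) = O(H) because κ ≥ 1.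
    have hg' : maxDensity F f (ρ * v) B n x ≤ A * H := by
      refine le_trans ?_ hyA
      refine le_of_mul_le_mul_right ((hg.trans hpow).trans ?_) hnpos
      rwa [mul_comm]
    have e0 : 0 ≤ (128 * (2 * E + A) + 27 / δ) * H := by positivity
    have e1 : (128 * (2 * E + A) + 27 / δ + A + 3 / δ) * H =
      (128 * (2 * E + A) + 27 / δ) * H + A * H + 3 / δ * H := by ring
    have e3 : 0 ≤ A * H := by positivity
    have e4 : 0 ≤ 3 / δ * H := by positivity
    rw [abs_le, e1]
    constructor <;> linarith

end GumbelRate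

/-! ### Exclusion of a finite right endpoint, and the conclusion. -/

namespace GumbelRate

variable {F f : ℝ → ℝ}

theorem tendsto_envelope_zero (hF : IsContinuousCdf F)
    (h : Tendsto (vonMisesFun F) (toRightEnd F) (𝓝 0)) :
    Tendsto (fun n => envelope F (centering F n)) atTop (𝓝 0) := by
  refine ENNReal.tendsto_nhds_zero.2 fun ε hε => ?_
  obtain ⟨r, -, hr0, hr⟩ := ENNReal.lt_iff_exists_real_btwn.1 hε
  have hr0' : 0 < r := ENNReal.ofReal_pos.1 hr0
  filter_upwards [tendsto_envelope_centering hF h hr0'] with n hn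
  exact hn.trans hr.le

/-- The growth conditions on the envelope rule out a finite right extremity. -/
theorem lt_one_of_envelope_bounds (hF : IsContinuousCdf F) (hvM : VonMisesCondition F f)
    {u : ℝ → ℝ} (hu : u = meanExcess F ∨ u = invEtaDeriv F) {b : ℕ → ℝ}
    (hb : ∀ n, b n = centering F n) {γ : ℝ} {k D : ℝ≥0∞} (hD : D ≠ ⊤) (hγ0 : 0 < γ)
    (hγ1 : γ < 1)
    (h1 : ∀ᶠ n in atTop, 0 < b n ∧
      ENNReal.ofReal (u (b n)) ≤ k * (ENNReal.ofReal (b n) * envelope F (b n)))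
    (h2 : ∀ᶠ n in atTop, envelope F (b n * (1 - γ)) ≤ D * envelope F (b n)) (x : ℝ) :
    F x < 1 := by
  by_contra hx
  have hx1 : F x = 1 := le_antisymm (hF.le_one x) (not_lt.1 hx)
  set S := {y | F y < 1} with hS
  have hbdd : BddAbove S := ⟨x, fun y (hy : F y < 1) => by
    by_contra hlt
    exact absurd (hF.mono (not_le.1 hlt).le) (not_le.2 (hx1 ▸ hy))⟩
  have hne : S.Nonempty := (hF.tendsto_atBot.eventually (gt_mem_nhds one_pos)).exists
  set r := sSup S with hr
  have hlt : ∀ y, F y < 1 → y < r := fun y hy => by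
    obtain ⟨z, hz, hz1⟩ := hF.exists_gt_lt_one hy
    exact hz.trans_le (le_csSup hbdd hz1)
  have hlt' : ∀ y, y < r → F y < 1 := fun y hy => by
    obtain ⟨z, hz, hyz⟩ := exists_lt_of_lt_csSup hne hy
    exact (hF.mono hyz.le).trans_lt hz
  have hbr : ∀ᶠ n in atTop, 0 < b n ∧ b n < r := by
    filter_upwards [h1, eventually_ge_atTop 2] with n hn hn2
    exact ⟨hn.1, hlt _ (by rw [hb n]; exact hF.centering_lt_one hn2)⟩
  obtain ⟨m, hm0, hmr⟩ := hbr.exists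
  have hr0 : 0 < r := hm0.trans hmr
  have hxs : F (r * (1 - γ)) < 1 := hlt' _ (by nlinarith)
  -- As b_n < r, h(r(1 - γ)) ≤ h(b_n(1 - γ)) ≤ D h(b_n), which tends to 0.
  have hzero : envelope F (r * (1 - γ)) = 0 := by
    have ht := ENNReal.Tendsto.const_mul (tendsto_envelope_zero hF hvM.2) (Or.inr hD)
    rw [mul_zero] at ht
    refine le_antisymm (ge_of_tendsto ht ?_) zero_le
    filter_upwards [hbr, h2] with n hn hn2
    rw [← hb n]
    refine le_trans (envelope_antitone F ?_) hn2
    nlinarith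
  obtain ⟨l, hl, -, hreg⟩ := hvM.exists_regular hF
  obtain ⟨n, hn1, hnl, hnx, hn2⟩ := (h1.and ((hF.eventually_lt_centering hl).and
    ((hF.eventually_lt_centering hxs).and (eventually_ge_atTop 2)))).exists
  have hlt1 : F (b n) < 1 := by rw [hb n]; exact hF.centering_lt_one hn2
  rw [← hb n] at hnl hnx
  -- With h(b_n) = 0 the first growth condition forces u(b_n) ≤ 0, against the positivity of u.
  have henv : envelope F (b n) = 0 :=
    le_antisymm ((envelope_antitone F hnx.le).trans hzero.le) zero_le
  have hupos : 0 < u (b n) := by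
    rcases hu with rfl | rfl
    · exact meanExcess_pos_of_eq_one hF hx1 hlt1
    · exact (hreg (b n) hnl hlt1).2.2.2.2.1
  have := hn1.2
  rw [henv, mul_zero, mul_zero, nonpos_iff_eq_zero, ENNReal.ofReal_eq_zero] at this
  linarith

theorem isContinuousCdf_of_density {μ : Measure ℝ} [IsProbabilityMeasure μ]
    (hF : ∀ x, F x = μ.real (Set.Iic x))
    (hμ : μ = volume.withDensity (fun x => ENNReal.ofReal (f x))) (hfb : BddAbove (Set.range f)) :
    IsContinuousCdf F := by
  obtain ⟨M, hM⟩ := hfb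
  have hc := (lipschitzWith_of_density_le hF hμ (M := M) fun x => hM ⟨x, rfl⟩).continuous
  have he := eq_cdf hF
  exact ⟨he ▸ monotone_cdf μ, hc, he ▸ tendsto_cdf_atBot μ, he ▸ tendsto_cdf_atTop μ⟩

end GumbelRate

theorem mainTheorem1 {Ω : Type*} [MeasurableSpace Ω] (P : Measure Ω) [IsProbabilityMeasure P]
    -- i.i.d. random variables with distribution function `F` and bounded density `f`
    (X : ℕ → Ω → ℝ) (hXm : ∀ i, Measurable (X i)) (hXind : iIndepFun X P)
    (F f : ℝ → ℝ)
    (hF : ∀ i x, F x = P.real {ω | X i ω ≤ x})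
    (hfm : Measurable f) (hf0 : ∀ x, 0 ≤ f x)
    (hf : ∀ i, P.map (X i) = volume.withDensity (fun x => ENNReal.ofReal (f x)))
    (hfb : BddAbove (Set.range f))
    (hdom : GumbelRate.InGumbelDomain F)
    (hvM : GumbelRate.VonMisesCondition F f)
    -- the auxiliary function, in either of its two usual forms, and the norming constants
    (u : ℝ → ℝ) (hu : u = GumbelRate.meanExcess F ∨ u = GumbelRate.invEtaDeriv F)
    (a b : ℕ → ℝ) (hb : ∀ n, b n = GumbelRate.centering F n) (ha : ∀ n, a n = u (b n))
    (k c p d : ℝ) (hk : 0 < k) (hc : 0 < c) (hck : c < k⁻¹) (hp : 0 < p) (hd : 0 < d)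
    (n₀ : ℕ)
    (h1 : ∀ n ≥ n₀, 0 < b n ∧
      ENNReal.ofReal (u (b n)) / (ENNReal.ofReal (b n) * GumbelRate.envelope F (b n))
        ≤ ENNReal.ofReal k)
    (h2 : ∀ n ≥ n₀,
      GumbelRate.envelope F (b n * (1 - c * k)) / GumbelRate.envelope F (b n)
        ≤ ENNReal.ofReal (d * (1 - c * k) ^ (-p))) :
    -- `g_n` is a density of the normalized maximum
    (∀ᶠ n : ℕ in atTop,
      P.map (fun ω => ((⨆ i : Fin n, X i ω) - b n) / a n) =
        volume.withDensity
          (fun x => ENNReal.ofReal (GumbelRate.maxDensity F f (a n) (b n) n x))) ∧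
    ∃ R₁ R₂ R₃ : ℕ → ℝ,
      R₁ =O[atTop] (fun n => (GumbelRate.envelope F (b n)).toReal) ∧
      R₂ =O[atTop] (fun n => Real.log (1 + (GumbelRate.envelope F (b n)).toReal)) ∧
      R₃ =O[atTop] (fun n : ℕ => (n : ℝ) * Real.exp (-Real.sqrt n)) ∧
      ∀ᶠ n : ℕ in atTop,
        BddAbove (Set.range fun x : ℝ =>
          |GumbelRate.maxDensity F f (a n) (b n) n x - GumbelRate.gumbelDensity x|) ∧
        (⨆ x : ℝ, |GumbelRate.maxDensity F f (a n) (b n) n x - GumbelRate.gumbelDensity x|)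
          < R₁ n + R₂ n + R₃ n := by
  have hprob : IsProbabilityMeasure (P.map (X 0)) :=
    Measure.isProbabilityMeasure_map (hXm 0).aemeasurable
  have hF0 : ∀ x, F x = (P.map (X 0)).real (Set.Iic x) := fun x => by
    rw [hF 0, measureReal_def, measureReal_def, Measure.map_apply (hXm 0) measurableSet_Iic]; rfl
  have hcdf := GumbelRate.isContinuousCdf_of_density hF0 (hf 0) hfb
  obtain ⟨M, hM⟩ := hfb
  have hγ0 : 0 < c * k := mul_pos hc hk
  have hγ1 : c * k < 1 := by
    rwa [lt_inv_comm₀ hc hk, ← one_div, lt_div_iff₀ hc, mul_comm] at hck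
  have hD : 0 < d * (1 - c * k) ^ (-p) := mul_pos hd (Real.rpow_pos_of_pos (by linarith) _)
  have h1' : ∀ᶠ n in atTop, 0 < b n ∧ ENNReal.ofReal (u (b n)) ≤
      ENNReal.ofReal k * (ENNReal.ofReal (b n) * GumbelRate.envelope F (b n)) := by
    filter_upwards [eventually_ge_atTop n₀] with n hn
    exact ⟨(h1 n hn).1, (ENNReal.div_le_iff_le_mul (Or.inr ENNReal.ofReal_ne_top)
      (Or.inr (ENNReal.ofReal_pos.2 hk).ne')).1 (h1 n hn).2⟩
  have h2' : ∀ᶠ n in atTop, GumbelRate.envelope F (b n * (1 - c * k)) ≤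
      ENNReal.ofReal (d * (1 - c * k) ^ (-p)) * GumbelRate.envelope F (b n) := by
    filter_upwards [eventually_ge_atTop n₀] with n hn
    exact (ENNReal.div_le_iff_le_mul (Or.inr ENNReal.ofReal_ne_top)
      (Or.inr (ENNReal.ofReal_pos.2 hD).ne')).1 (h2 n hn)
  have hF1 := GumbelRate.lt_one_of_envelope_bounds hcdf hvM hu hb ENNReal.ofReal_ne_top hγ0 hγ1
    h1' h2'
  have h1'' : ∀ᶠ n in atTop, 0 < b n ∧
      u (b n) ≤ k * (b n * (GumbelRate.envelope F (b n)).toReal) := by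
    filter_upwards [h1', GumbelRate.tendsto_envelope_centering hcdf hvM.2 one_pos] with n hn henv
    rw [← hb n] at henv
    have htop : GumbelRate.envelope F (b n) ≠ ⊤ := (henv.trans_lt ENNReal.ofReal_lt_top).ne
    refine ⟨hn.1, ?_⟩
    have h3 := (ENNReal.ofReal_le_iff_le_toReal (ENNReal.mul_ne_top ENNReal.ofReal_ne_top
      (ENNReal.mul_ne_top ENNReal.ofReal_ne_top htop))).1 hn.2
    rwa [ENNReal.toReal_mul, ENNReal.toReal_mul, ENNReal.toReal_ofReal hk.le,
      ENNReal.toReal_ofReal hn.1.le] at h3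
  obtain ⟨C, hC⟩ := GumbelRate.exists_uniform_bound hcdf hvM hF1 hf0 (fun x => hM ⟨x, rfl⟩) hu hb hk
    hγ0 hγ1 h1'' h2'
  -- The remainder of order `h(b_n)` dominates the other two, so it suffices alone.
  refine ⟨?_, fun n => (C + 1) * (GumbelRate.envelope F (b n)).toReal, fun _ => 0, fun _ => 0,
    isBigO_const_mul_self _ _ _, isBigO_zero _ _, isBigO_zero _ _, ?_⟩
  · filter_upwards [hC, eventually_ne_atTop 0] with n hn hn0
    rw [ha n]
    exact GumbelRate.map_normalized_iSup P X hXm hXind hF hfm hf0 hf ⟨M, hM⟩ hn0 hn.1 (b n)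
  · filter_upwards [hC] with n hn
    rw [ha n]
    -- Strictness comes from `C + 1` in place of `C` and h(b_n) > 0.
    refine ⟨⟨_, Set.forall_mem_range.2 hn.2.2⟩, (ciSup_le hn.2.2).trans_lt ?_⟩
    linarith [hn.2.1]
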